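/- Let $G$ be a nontrivial group. A positive cone of $G$ is a subset $P\subset G$ with $P\cdot P\subset P$ and $P\cup P^{-1}=G\setminus\{1\}$; it encodes the left-ordering $g<h \iff g^{-1}h\in P$, and $\mathrm{LO}(G)$ denotes the set of all left-orderings of $G$. A circular ordering of $G$ is a map $c:G^3\to\{0,\pm1\}$ such that (i) $c(g_1,g_2,g_3)=0$ if and only if $g_1,g_2,g_3$ are not all distinct; (ii) $c(g_1,g_2,g_3)-c(g_1,g_2,g_4)+c(g_1,g_3,g_4)-c(g_2,g_3,g_4)=0$ for all $g_i\in G$; (iii) $c(gg_1,gg_2,gg_3)=c(g_1,g_2,g_3)$ for all $g,g_i\in G$. The set $\mathrm{CO}(G)$ of circular orderings carries the topology induced from the product topology on $\{0,\pm1\}^{G^3}$. Let $\iota:\mathrm{LO}(G)\to\mathrm{CO}(G)$ send $<$ to $c_<$, where $c_<(g_1,g_2,g_3)$ is the sign of the permutation $\sigma$ with $g_{\sigma(1)}<g_{\sigma(2)}<g_{\sigma(3)}$ if the $g_i$ are distinct, and $0$ otherwise. Let $\mathrm{CO}_g(G)=\mathrm{CO}(G)\setminus\iota(\mathrm{LO}(G))$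 be the set of genuine circular orderings. Suppose that $G$ is isomorphic to one of the following: 1. a finitely generated nilpotent group; 2. a braid group $B_n$, that is, the group with generators $\sigma_1,\dots,\sigma_{n-1}$ and relations $\sigma_i\sigma_j=\sigma_j\sigma_i$ for $|i-j|>1$, $\sigma_i\sigma_j\sigma_i=\sigma_j\sigma_i\sigma_j$ for $|i-j|=1$; 3. the fundamental group of a closed Seifert fibred manifold $M$ with base orbifold $S^2(\alpha_1,\dots,\alpha_n)$, where $n\ge 0$ and $\alpha_i\ge1$. Here $M$ is a compact Hausdorff space with a continuous map $p:M\to S^2$ and distinct points $x_1,\dots,x_n\in S^2$ such that every $b\in S^2$ has an open neighbourhood $U$ over which $p$ is isomorphic, by homeomorphisms $p^{-1}(U)\cong D\times S^1$ and $U\cong D$ taking $b$ to $0$, to a fibred solid torus $D\times S^1\to D$, $(z,w)\mapsto z^{a}w^{\nu}$, where $D\subset\mathbb{C}$ is the open unit disc, $S^1\subset\mathbb{C}$ is the unit circle, $\nu$ is an integer prime to $a$, and $a=\alpha_i$ if $b=x_i$, $a=1$ if $b\notin\{x_1,\dots,x_n\}$. Then $\mathrm{CO}_g(G)$ is dense in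 $\mathrm{CO}(G)$. In particular, for every left-ordering $<$ of $G$, the circular ordering $c_<$ is an accumulation point of $\mathrm{CO}_g(G)$, and it is the limit of a sequence of genuine circular orderings. -/

import Mathlib

open Set Filter Topology

/-- The left-orderings of `G`, as positive cones `P`: `P * P ⊆ P` and `P ∪ P⁻¹ = G \ {1}`. -/
def leftOrderings (G : Type*) [Group G] : Set (Set G) :=
  {P | (∀ g ∈ P, ∀ h ∈ P, g * h ∈ P) ∧ ∀ g : G, (g ∈ P ∨ g⁻¹ ∈ P) ↔ g ≠ 1}

/-- The strict order with positive cone `P`: `g < h` if and only if `g⁻¹ * h ∈ P`. -/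
def coneLT {G : Type*} [Group G] (P : Set G) (g h : G) : Prop :=
  g⁻¹ * h ∈ P

/-- The left-circular orderings of `G`, as a set of functions on triples with values in
`SignType` (that is, `{0, 1, -1}` with the discrete topology). The space `CO(G)` is the coercion
of this set to a type, with the topology induced by the product topology. -/
def circularOrderings (G : Type*) [Group G] : Set (G × G × G → SignType) :=
  {c | (∀ g₁ g₂ g₃ : G, c (g₁, g₂, g₃) = 0 ↔ ¬ (g₁ ≠ g₂ ∧ g₁ ≠ g₃ ∧ g₂ ≠ g₃)) ∧
    (∀ g₁ g₂ g₃ g₄ : G,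
      (c (g₁, g₂, g₃) : ℤ) - (c (g₁, g₂, g₄) : ℤ) + (c (g₁, g₃, g₄) : ℤ)
        - (c (g₂, g₃, g₄) : ℤ) = 0) ∧
    (∀ g g₁ g₂ g₃ : G, c (g * g₁, g * g₂, g * g₃) = c (g₁, g₂, g₃))}

open Classical in
/-- The function `c_<` on triples: `1` if the triple is put in increasing order by an even
permutation, `-1` if it is put in increasing order by an odd permutation, and `0` if its entries
are not distinct. -/
noncomputable def secretFun {G : Type*} [Group G] (P : Set G) : G × G × G → SignType :=
  fun t =>
    if (coneLT P t.1 t.2.1 ∧ coneLT P t.2.1 t.2.2) ∨ (coneLT P t.2.1 t.2.2 ∧ coneLT P t.2.2 t.1) ∨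
        (coneLT P t.2.2 t.1 ∧ coneLT P t.1 t.2.1) then 1
    else if (coneLT P t.2.1 t.1 ∧ coneLT P t.1 t.2.2) ∨
        (coneLT P t.1 t.2.2 ∧ coneLT P t.2.2 t.2.1) ∨
        (coneLT P t.2.2 t.2.1 ∧ coneLT P t.2.1 t.1) then -1
    else 0

section helpers

variable {G : Type*} [Group G] {P : Set G}

theorem coneLT_irrefl (hP : P ∈ leftOrderings G) (g : G) : ¬ coneLT P g g := by
  intro h
  have := (hP.2 (g⁻¹ * g)).1 (Or.inl h)
  simp at this

theorem coneLT_trans (hP : P ∈ leftOrderings G) {a b c : G} (h₁ : coneLT P a b)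
    (h₂ : coneLT P b c) : coneLT P a c := by
  have := hP.1 _ h₁ _ h₂
  simpa [coneLT, mul_assoc] using this

theorem coneLT_total (hP : P ∈ leftOrderings G) {a b : G} (h : a ≠ b) :
    coneLT P a b ∨ coneLT P b a := by
  have := (hP.2 (a⁻¹ * b)).2 (by simpa [inv_mul_eq_one] using h)
  simpa [coneLT] using this

theorem coneLT_mul_left (g a b : G) : coneLT P (g * a) (g * b) ↔ coneLT P a b := by
  simp [coneLT, mul_assoc]

theorem secretFun_mem (hP : P ∈ leftOrderings G) : secretFun P ∈ circularOrderings G := by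
  have irr := coneLT_irrefl hP
  have tr : ∀ a b c, coneLT P a b → coneLT P b c → coneLT P a c :=
    fun a b c => coneLT_trans hP
  have tot : ∀ a b, a ≠ b → coneLT P a b ∨ coneLT P b a := fun a b => coneLT_total hP
  refine ⟨?_, ?_, ?_⟩
  · intro a b c
    simp only [secretFun]
    by_cases hab : a = b <;> by_cases hac : a = c <;> by_cases hbc : b = c <;>
      split_ifs <;> grind
  · intro a b c d
    simp only [secretFun]
    by_cases hab : a = b <;> by_cases hac : a = c <;> by_cases hbc : b = c <;>
      by_cases had : a = d <;> by_cases hbd : b = d <;> by_cases hcd : c = d <;>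
      first
      | (exfalso; subst_vars; exact absurd rfl ‹_›)
      | grind [SignType.coe_one, SignType.coe_neg_one, SignType.coe_zero]
  · intro g a b c
    have key : ∀ x y, coneLT P (g * x) (g * y) ↔ coneLT P x y := coneLT_mul_left g
    simp only [secretFun]
    split_ifs <;> grind

end helpers

/-- The map `ι : LO(G) → CO(G)`, `< ↦ c_<`. -/
noncomputable def secretOrdering {G : Type*} [Group G] (P : leftOrderings G) :
    circularOrderings G :=
  ⟨secretFun P.1, secretFun_mem P.2⟩

/-- The genuine circular orderings `CO_g(G) = CO(G) \ ι(LO(G))`, as a subset of `CO(G)`. -/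
def genuineOrderings (G : Type*) [Group G] : Set (circularOrderings G) :=
  (range (secretOrdering (G := G)))ᶜ

/-- The relators of the braid group on `n` strands, in the generators `σ_0, …, σ_{n-2}`. -/
def braidRels (n : ℕ) : Set (FreeGroup (Fin (n - 1))) :=
  {r | ∃ i j : Fin (n - 1), (i : ℕ) + 1 < j ∧
      r = FreeGroup.of i * FreeGroup.of j * (FreeGroup.of j * FreeGroup.of i)⁻¹} ∪
  {r | ∃ i j : Fin (n - 1), (i : ℕ) + 1 = j ∧
      r = FreeGroup.of i * FreeGroup.of j * FreeGroup.of i *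
        (FreeGroup.of j * FreeGroup.of i * FreeGroup.of j)⁻¹}

/-- The braid group on `n` strands, by Artin's presentation. -/
abbrev BraidGroup (n : ℕ) : Type :=
  PresentedGroup (braidRels n)

/-- The open unit disc in the complex plane. -/
abbrev openDisc : Set ℂ := Metric.ball (0 : ℂ) 1

/-- The quotient map of the fibred solid torus of type `(a, ν)`, for `a ≥ 1` prime to `ν`, onto
its space of fibres. The fibres are the level sets of `(z, w) ↦ z ^ a * w ^ ν`, which are the orbits
of the circle action `t • (z, w) = (t ^ (-ν) * z, t ^ a * w)`: the core `z = 0` is a fibre, and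
every other fibre winds `a` times along it. The base is the disc `ℂ / (ℤ/a)`, coordinatized by
`z ^ a`; its centre is a cone point of order `a`, and a regular point if `a = 1`. -/
noncomputable def fibredTorusProj (a : ℕ) (ν : ℤ) (x : openDisc × Circle) : ℂ :=
  (x.1 : ℂ) ^ a * ((x.2 ^ ν : Circle) : ℂ)

/-- Over some open disc `U` around `b`, the map `p` is isomorphic to the projection of a fibred
solid torus of multiplicity `a`, in which the fibre over `b` is the core. -/
def HasFibredTorusNhd {M B : Type*} [TopologicalSpace M] [TopologicalSpace B] (p : M → B)
    (b : B) (a : ℕ) : Prop :=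
  ∃ (ν : ℤ) (U : Set B) (hb : b ∈ U) (φ : U ≃ₜ openDisc)
    (Φ : (p ⁻¹' U) ≃ₜ openDisc × Circle),
    IsCoprime (a : ℤ) ν ∧ IsOpen U ∧ ((φ ⟨b, hb⟩ : openDisc) : ℂ) = 0 ∧
      ∀ m : p ⁻¹' U, ((φ ⟨p m, m.2⟩ : openDisc) : ℂ) = fibredTorusProj a ν (Φ m)

/-- The two-sphere. -/
abbrev TwoSphere : Type := Metric.sphere (0 : EuclideanSpace ℝ (Fin 3)) 1

/-- `M` is a closed Seifert fibred manifold with base orbifold `S²(α_1, …, α_n)`: it is compact and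
Hausdorff, and it has a map to the two-sphere whose fibres are circles, with a fibred solid torus
neighbourhood of multiplicity `α_i` around the fibre over the cone point `x_i`, and of multiplicity
one around every other fibre. That `M` is a connected three-manifold follows, as it is covered by
open solid tori. -/
def IsClosedSeifertOverSphere (M : Type*) [TopologicalSpace M] {n : ℕ} (α : Fin n → ℕ) : Prop :=
  CompactSpace M ∧ T2Space M ∧ (∀ i, 1 ≤ α i) ∧
    ∃ (p : M → TwoSphere) (x : Fin n → TwoSphere), Continuous p ∧ Function.Injective x ∧
      (∀ i, HasFibredTorusNhd p (x i) (α i)) ∧ ∀ b, b ∉ range x → HasFibredTorusNhd p b 1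

/-! ### Signs of triples under cyclic rotation -/

section CyclicQuotient

variable {Γ : Type*} [Group Γ] {Q : Set Γ}

/-! A circular ordering that is not genuine is some `c_<`, so everything reduces to approximating
each `c_<` by genuine orderings. Suppose `z` is positive, central and cofinal, meaning that every
element lies below a power of `z`. Order `G × ℤ` so that the generator `t` of `ℤ` acts like `z ^ N`.
Then `t` is central, positive and cofinal, and `G = (G × ℤ) / ⟨t⟩` inherits a circular ordering by
wrapping the window `[1, t)` into a circle. It agrees with `c_<` on a given finite set once `N` is
large. It is genuine because the powers of `z` go around the circle, whereas they would be monotone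
for a left-ordering. It is enough that `z` is central and cofinal in a totally preordered quotient
of `G`, with ties broken by `<`: this is `exists_genuine_tendsto`.

For nilpotent `G`, let `C` be a maximal proper convex subgroup, which exists by finite generation,
and divide by its normal core. A nontrivial central element of the quotient lifts to `z` outside
`C`, and maximality of `C` makes it cofinal.

Braid and Seifert groups are generated by roots of elements of a normal cyclic subgroup `⟨h⟩`.
Left-orderability rules out torsion, so `h` is central, and `h` or `h⁻¹` is cofinal because each
generator has a power in `⟨h⟩`. In a braid group, `δ = σ_0 ⋯ σ_{n-2}` and `ε = σ_0 δ` generate and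
`ε ^ (n - 1) = δ ^ n`. In a Seifert group, `h` is a regular fibre, and a van Kampen argument over
the sphere shows that conjugates of loops in fibred solid tori generate. -/

theorem coneLT_asymm (hQ : Q ∈ leftOrderings Γ) {a b : Γ} (h : coneLT Q a b) : ¬ coneLT Q b a :=
  fun h' => coneLT_irrefl hQ a (coneLT_trans hQ h h')

/-- The sign of a triple depends only on the order relations between its entries. -/
theorem secretFun_congr {G H : Type*} [Group G] [Group H] {P : Set G} {Q : Set H}
    {a b c : G} {a' b' c' : H}
    (h₁ : coneLT P a b ↔ coneLT Q a' b') (h₂ : coneLT P b a ↔ coneLT Q b' a')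
    (h₃ : coneLT P a c ↔ coneLT Q a' c') (h₄ : coneLT P c a ↔ coneLT Q c' a')
    (h₅ : coneLT P b c ↔ coneLT Q b' c') (h₆ : coneLT P c b ↔ coneLT Q c' b') :
    secretFun P (a, b, c) = secretFun Q (a', b', c') := by
  simp only [secretFun]
  congr 1
  · rw [h₁, h₄, h₅]
  · congr 1
    rw [h₂, h₃, h₆]

theorem secretFun_rotate {a b c : Γ} : secretFun Q (b, c, a) = secretFun Q (a, b, c) := by
  simp only [secretFun]
  congr 1
  · grind
  · congr 1
    grind

/-- Moving the points of a window `[x, x * t)` that lie beyond `t` back by `t` does not change the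
sign of a triple. -/
theorem secretFun_wrap (hQ : Q ∈ leftOrderings Γ) {x y : Fin 3 → Γ} (w : Fin 3 → Prop)
    (h_same : ∀ i j, (w i ↔ w j) → (coneLT Q (y i) (y j) ↔ coneLT Q (x i) (x j)))
    (h_wrap : ∀ i j, ¬ w i → w j → coneLT Q (x i) (x j) ∧ coneLT Q (y j) (y i)) :
    secretFun Q (y 0, y 1, y 2) = secretFun Q (x 0, x 1, x 2) := by
  have as : ∀ a b, coneLT Q a b → ¬ coneLT Q b a := fun a b => coneLT_asymm hQ
  have s01 := h_same 0 1
  have s10 := h_same 1 0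
  have s02 := h_same 0 2
  have s20 := h_same 2 0
  have s12 := h_same 1 2
  have s21 := h_same 2 1
  have w01 := h_wrap 0 1
  have w10 := h_wrap 1 0
  have w02 := h_wrap 0 2
  have w20 := h_wrap 2 0
  have w12 := h_wrap 1 2
  have w21 := h_wrap 2 1
  have a01 := as (x 0) (x 1)
  have a02 := as (x 0) (x 2)
  have a12 := as (x 1) (x 2)
  have b01 := as (y 0) (y 1)
  have b02 := as (y 0) (y 2)
  have b12 := as (y 1) (y 2)
  clear h_same h_wrap as
  simp only [secretFun]
  generalize coneLT Q (x 0) (x 1) = X01 at *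
  generalize coneLT Q (x 0) (x 2) = X02 at *
  generalize coneLT Q (x 1) (x 2) = X12 at *
  generalize coneLT Q (x 1) (x 0) = X10 at *
  generalize coneLT Q (x 2) (x 0) = X20 at *
  generalize coneLT Q (x 2) (x 1) = X21 at *
  generalize coneLT Q (y 0) (y 1) = Y01 at *
  generalize coneLT Q (y 0) (y 2) = Y02 at *
  generalize coneLT Q (y 1) (y 2) = Y12 at *
  generalize coneLT Q (y 1) (y 0) = Y10 at *
  generalize coneLT Q (y 2) (y 0) = Y20 at *
  generalize coneLT Q (y 2) (y 1) = Y21 at *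
  -- The wrapped points are a final segment of the triple that becomes an initial one, so each case
  -- is a cyclic rotation, which is an even permutation.
  by_cases h0 : w 0 <;> by_cases h1 : w 1 <;> by_cases h2 : w 2 <;>
    simp only [h0, h1, h2, true_iff, iff_true, forall_const, not_true_eq_false, not_false_eq_true,
      false_implies, iff_self, implies_true] at * <;>
    split_ifs <;> grind

end CyclicQuotient

/-! ### The circular ordering of `G` from a cofinal central element of `G × ℤ` -/

section CircularOrder

variable {G : Type*} [Group G]

/-- The element `(g, n)` of `G × ℤ`, written multiplicatively. -/
abbrev pairZ (g : G) (n : ℤ) : G × Multiplicative ℤ := (g, Multiplicative.ofAdd n)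

theorem pairZ_mul (g h : G) (m n : ℤ) : pairZ g m * pairZ h n = pairZ (g * h) (m + n) := rfl

theorem pairZ_inv (g : G) (m : ℤ) : (pairZ g m)⁻¹ = pairZ g⁻¹ (-m) := rfl

theorem coneLT_pairZ {Q : Set (G × Multiplicative ℤ)} {g h : G} {m n : ℤ} :
    coneLT Q (pairZ g m) (pairZ h n) ↔ pairZ (g⁻¹ * h) (n - m) ∈ Q := by
  rw [coneLT, pairZ_inv, pairZ_mul, neg_add_eq_sub]

theorem coneLT_pairZ_shift {Q : Set (G × Multiplicative ℤ)} {g h : G} {m n : ℤ} (k : ℤ) :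
    coneLT Q (pairZ g (m + k)) (pairZ h (n + k)) ↔ coneLT Q (pairZ g m) (pairZ h n) := by
  rw [coneLT_pairZ, coneLT_pairZ, add_sub_add_right_eq_sub]

/-- A left-ordering of `G × ℤ` in which the generator of `ℤ` is positive and cofinal. -/
structure IsCofinalCone (Q : Set (G × Multiplicative ℤ)) : Prop where
  mem : Q ∈ leftOrderings (G × Multiplicative ℤ)
  pos : pairZ (1 : G) 1 ∈ Q
  bdd : ∀ g : G, ∃ n : ℤ, coneLT Q (pairZ g 0) (pairZ 1 n)

namespace IsCofinalCone

variable {Q : Set (G × Multiplicative ℤ)} (hQ : IsCofinalCone Q)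
include hQ

theorem mono (g : G) {m n : ℤ} (h : m < n) : coneLT Q (pairZ g m) (pairZ g n) := by
  obtain ⟨k, rfl⟩ : ∃ k : ℕ, n = m + (k + 1 : ℕ) := ⟨(n - m - 1).toNat, by grind⟩
  rw [coneLT_pairZ, inv_mul_cancel, add_sub_cancel_left]
  clear h
  induction k with
  | zero => exact hQ.pos
  | succ k ih => 
    have := hQ.mem.1 _ ih _ hQ.pos
    rwa [pairZ_mul, one_mul] at this

theorem exists_window (g : G) :
    ∃ n : ℤ, ¬ coneLT Q (pairZ g n) (pairZ 1 0) ∧ coneLT Q (pairZ g n) (pairZ 1 1) := by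
  obtain ⟨a, ha⟩ := hQ.bdd g
  obtain ⟨b, hb⟩ := hQ.bdd g⁻¹
  have up : ∀ n : ℤ, coneLT Q (pairZ g n) (pairZ 1 0) → n ≤ b := by
    intro n hn
    by_contra! h
    have h₁ := coneLT_trans hQ.mem (hQ.mono g h) hn
    rw [coneLT_pairZ] at hb h₁
    have := hQ.mem.1 _ hb _ h₁
    rw [pairZ_mul] at this
    simp only [inv_inv, mul_one, mul_inv_cancel, sub_zero, zero_sub, add_neg_cancel] at this
    exact (hQ.mem.2 1).1 (Or.inl this) rfl
  -- If `n` is the last integer with `g tⁿ < 1`, then `1 ≤ g tⁿ⁺¹ < t`.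
  obtain ⟨n, hn, hmax⟩ := Int.exists_greatest_of_bdd ⟨b, up⟩ ⟨-a, by
    simpa using (coneLT_pairZ_shift (-a)).2 ha⟩
  refine ⟨n + 1, fun h => ?_, ?_⟩
  · have := hmax _ h
    omega
  · simpa using (coneLT_pairZ_shift 1).2 hn

/-- The integer that moves `g` into the window `[1, t)`. -/
noncomputable def level (g : G) : ℤ := (hQ.exists_window g).choose

theorem level_unique {g : G} {n : ℤ} (h₀ : ¬ coneLT Q (pairZ g n) (pairZ 1 0))
    (h₁ : coneLT Q (pairZ g n) (pairZ 1 1)) : hQ.level g = n := by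
  have aux : ∀ m k : ℤ, ¬ coneLT Q (pairZ g m) (pairZ 1 0) → coneLT Q (pairZ g k) (pairZ 1 1) →
      k ≤ m := by
    intro m k hm hk
    by_contra! h
    apply hm
    have hk' : coneLT Q (pairZ g (k - 1)) (pairZ 1 0) := by
      simpa [← sub_eq_add_neg] using (coneLT_pairZ_shift (-1)).2 hk
    rcases (Int.le_sub_one_of_lt h).lt_or_eq with h | h
    · exact coneLT_trans hQ.mem (hQ.mono g h) hk'
    · rwa [h]
  have h := (hQ.exists_window g).choose_spec
  exact le_antisymm (aux _ _ h₀ h.2) (aux _ _ h.1 h₁)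

/-- The representative of `g` in the window `[1, t)`. -/
noncomputable def lift (g : G) : G × Multiplicative ℤ := pairZ g (hQ.level g)

theorem not_lift_lt (g : G) : ¬ coneLT Q (hQ.lift g) (pairZ 1 0) :=
  (hQ.exists_window g).choose_spec.1

theorem lift_lt (g : G) : coneLT Q (hQ.lift g) (pairZ 1 1) :=
  (hQ.exists_window g).choose_spec.2

theorem lift_injective : Function.Injective hQ.lift := fun _ _ h => congrArg Prod.fst h

/-- The cyclic order on `G = (G × ℤ) / ℤ`. -/
noncomputable def circFun (t : G × G × G) : SignType :=
  secretFun Q (hQ.lift t.1, hQ.lift t.2.1, hQ.lift t.2.2)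

/-- Left multiplication by the lift `g̃` of `g` preserves the order and carries the window `[1, t)`
onto `[g̃, g̃ t)`. Moving the points beyond `t` back by `t` restores the standard lifts and only
rotates triples cyclically. -/
theorem circFun_mul (g g₁ g₂ g₃ : G) :
    hQ.circFun (g * g₁, g * g₂, g * g₃) = hQ.circFun (g₁, g₂, g₃) := by
  set f : Fin 3 → G := ![g₁, g₂, g₃]
  have key := secretFun_wrap hQ.mem (x := fun i => hQ.lift g * hQ.lift (f i))
    (y := fun i => hQ.lift (g * f i))
    (fun i => ¬ coneLT Q (hQ.lift g * hQ.lift (f i)) (pairZ 1 1))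
  have prod : ∀ i, hQ.lift g * hQ.lift (f i) = pairZ (g * f i) (hQ.level g + hQ.level (f i)) :=
    fun i => rfl
  have h0 : ∀ i, ¬ coneLT Q (hQ.lift g * hQ.lift (f i)) (hQ.lift g) := by
    intro i h
    apply hQ.not_lift_lt (f i)
    rw [← coneLT_mul_left (hQ.lift g)]
    convert h using 1
    exact mul_one _
  have h2 : ∀ i, coneLT Q (hQ.lift g * hQ.lift (f i)) (pairZ g (hQ.level g + 1)) := by
    intro i
    have := hQ.lift_lt (f i)
    rw [← coneLT_mul_left (hQ.lift g)] at this
    convert this using 1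
    rw [lift, pairZ_mul, mul_one]
  have le_trans' : ∀ a b c : G × Multiplicative ℤ, ¬ coneLT Q b a → coneLT Q b c →
      coneLT Q a c := by
    intro a b c hab hbc
    by_cases h : a = b
    · rwa [h]
    · exact coneLT_trans hQ.mem ((coneLT_total hQ.mem h).resolve_right hab) hbc
  have lo : ∀ i, coneLT Q (hQ.lift g * hQ.lift (f i)) (pairZ 1 1) →
      hQ.lift (g * f i) = hQ.lift g * hQ.lift (f i) := by
    intro i hi
    rw [prod] at hi ⊢
    rw [lift, hQ.level_unique ?_ hi]
    intro h
    exact hQ.not_lift_lt g (le_trans' _ _ _ (h0 i) h)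
  have hi : ∀ i, ¬ coneLT Q (hQ.lift g * hQ.lift (f i)) (pairZ 1 1) →
      hQ.lift (g * f i) = pairZ (g * f i) (hQ.level g + hQ.level (f i) + -1) := by
    intro i hi
    rw [lift, hQ.level_unique (n := hQ.level g + hQ.level (f i) + -1)]
    · intro h
      apply hi
      rw [prod]
      simpa using (coneLT_pairZ_shift 1).2 h
    · have h₁ := coneLT_trans hQ.mem (h2 i)
        ((coneLT_pairZ_shift 1).2 (hQ.lift_lt g))
      rw [prod] at h₁
      simpa using (coneLT_pairZ_shift (-1)).2 h₁
  have res := key ?_ ?_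
  · refine res.trans ?_
    apply secretFun_congr <;> exact coneLT_mul_left _ _ _
  · intro i j hij
    by_cases h : coneLT Q (hQ.lift g * hQ.lift (f i)) (pairZ 1 1)
    · rw [lo i h, lo j (by tauto)]
    · rw [hi i h, hi j (by tauto), coneLT_pairZ_shift]
      rfl
  · intro i j h₁ h₂
    rw [not_not] at h₁
    constructor
    · by_contra h
      exact h₂ (le_trans' _ _ _ h h₁)
    · rw [lo i h₁, hi j h₂]
      have h₃ : coneLT Q (pairZ (g * f j) (hQ.level g + hQ.level (f j) + -1)) (hQ.lift g) := by
        have := h2 j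
        rw [prod] at this
        have := (coneLT_pairZ_shift (-1)).2 this
        rwa [add_neg_cancel_right] at this
      by_contra h
      exact h0 i (le_trans' _ _ _ h h₃)

theorem circFun_mem : hQ.circFun ∈ circularOrderings G := by
  have h := secretFun_mem hQ.mem
  refine ⟨fun a b c => ?_, fun a b c d => h.2.1 _ _ _ _, hQ.circFun_mul⟩
  have := h.1 (hQ.lift a) (hQ.lift b) (hQ.lift c)
  simp only [ne_eq, hQ.lift_injective.eq_iff] at this
  exact this

end IsCofinalCone

end CircularOrder

/-! ### Agreement with the left-ordering on small sets, and genuineness -/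

theorem secretFun_of_lt {G : Type*} [Group G] {P : Set G} {a b c : G} (hab : coneLT P a b)
    (hbc : coneLT P b c) : secretFun P (a, b, c) = 1 := by
  simp only [secretFun]
  rw [if_pos (Or.inl ⟨hab, hbc⟩)]

theorem secretFun_of_lt_swap {G : Type*} [Group G] {P : Set G} (hP : P ∈ leftOrderings G)
    {a b c : G} (hac : coneLT P a c) (hcb : coneLT P c b) : secretFun P (a, b, c) = -1 := by
  have h₁ := coneLT_asymm hP hac
  have h₂ := coneLT_asymm hP hcb
  simp only [secretFun]
  rw [if_neg (by tauto), if_pos (Or.inr (Or.inl ⟨hac, hcb⟩))]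

namespace IsCofinalCone

variable {G : Type*} [Group G] {Q : Set (G × Multiplicative ℤ)} (hQ : IsCofinalCone Q)
include hQ

/-- The circular ordering of `G = (G × ℤ) / ℤ`. -/
noncomputable def circ : circularOrderings G := ⟨hQ.circFun, hQ.circFun_mem⟩

theorem lift_eq {P : Set G} (h : ∀ g, pairZ g 0 ∈ Q ↔ g ∈ P) {g : G}
    (hg : ¬ coneLT P g 1) (hg' : coneLT Q (pairZ g 0) (pairZ 1 1)) : hQ.lift g = pairZ g 0 := by
  rw [lift, hQ.level_unique ?_ hg']
  rwa [coneLT_pairZ, sub_zero, h]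

/-- The circular ordering agrees with the left-ordering on triples of small diameter. -/
theorem circFun_eq_secretFun {P : Set G} (hP : P ∈ leftOrderings G)
    (h : ∀ g, pairZ g 0 ∈ Q ↔ g ∈ P) {s : Set G}
    (hs : ∀ a ∈ s, ∀ b ∈ s, coneLT Q (pairZ (a⁻¹ * b) 0) (pairZ 1 1)) {a b c : G}
    (ha : a ∈ s) (hb : b ∈ s) (hc : c ∈ s) :
    hQ.circFun (a, b, c) = secretFun P (a, b, c) := by
  -- Translating by the inverse of the least entry `m` puts all three entries in `[1, t)`, so that
  -- they lift with level `0`.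
  obtain ⟨m, hm, hma, hmb, hmc⟩ :
      ∃ m ∈ s, ¬ coneLT P a m ∧ ¬ coneLT P b m ∧ ¬ coneLT P c m := by
    have ir := coneLT_irrefl hP
    have tr : ∀ x y z, coneLT P x y → coneLT P y z → coneLT P x z :=
      fun x y z => coneLT_trans hP
    by_cases h₁ : coneLT P a b <;> by_cases h₂ : coneLT P b c <;> by_cases h₃ : coneLT P a c
    all_goals first
      | exact ⟨a, ha, by grind, by grind, by grind⟩
      | exact ⟨b, hb, by grind, by grind, by grind⟩
      | exact ⟨c, hc, by grind, by grind, by grind⟩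
  have key : ∀ x ∈ s, ¬ coneLT P x m → hQ.lift (m⁻¹ * x) = pairZ (m⁻¹ * x) 0 := by
    intro x hx hxm
    refine hQ.lift_eq h (fun h' => hxm ?_) (hs m hm x hx)
    rw [← coneLT_mul_left m] at h'
    simpa using h'
  have e : ∀ x y, coneLT Q (pairZ (m⁻¹ * x) 0) (pairZ (m⁻¹ * y) 0) ↔ coneLT P x y := by
    intro x y
    rw [coneLT_pairZ, sub_zero, h, ← coneLT_mul_left m⁻¹, coneLT]
  rw [← hQ.circFun_mul m⁻¹, circFun]
  simp only [key a ha hma, key b hb hmb, key c hc hmc]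
  apply secretFun_congr <;> exact e _ _

/-- In a left-ordering the powers of `z` are monotone. Here `1, z, z²` are in positive position, but
the first power `z ^ j` past `t` lifts to `z ^ j t⁻¹`, between `1` and `z`. So `(1, z ^ (j - 1), z ^
j)` is in negative position. -/
theorem circ_mem_genuineOrderings {P : Set G} (hP : P ∈ leftOrderings G)
    (h : ∀ g, pairZ g 0 ∈ Q ↔ g ∈ P) {z : G} (hz : z ∈ P)
    (hz₂ : coneLT Q (pairZ (z * z) 0) (pairZ 1 1))
    {k : ℕ} (hk : ¬ coneLT Q (pairZ (z ^ k) 0) (pairZ 1 1)) :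
    hQ.circ ∈ genuineOrderings G := by
  rintro ⟨⟨P', hP'⟩, hP'c⟩
  have hc : ∀ a b c, secretFun P' (a, b, c) = hQ.circFun (a, b, c) := fun a b c =>
    congrFun (congrArg Subtype.val hP'c) (a, b, c)
  have hz0 : ∀ g, coneLT Q (pairZ g 0) (pairZ (g * z) 0) := by
    intro g
    rw [coneLT_pairZ, sub_zero, h]
    simpa using hz
  have pw : ∀ {R : Set G}, R ∈ leftOrderings G → z ∈ R → ∀ i j, coneLT R (z ^ i) (z ^ (i + j + 1)) := by
    intro R hR hzR i j
    induction j with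
    | zero => simpa [coneLT, pow_succ] using hzR
    | succ j ih =>
      refine coneLT_trans hR ih ?_
      rwa [coneLT, ← add_assoc, pow_succ z (i + j + 1), inv_mul_cancel_left]
  have nlt : ∀ i, ¬ coneLT P (z ^ i) 1 := by
    intro i hi
    rcases i with _ | i
    · exact coneLT_irrefl hP _ (by simpa using hi)
    · exact coneLT_asymm hP hi (by simpa using pw hP hz 0 i)
  have small : ∀ i, coneLT Q (pairZ (z ^ i) 0) (pairZ 1 1) → hQ.lift (z ^ i) = pairZ (z ^ i) 0 :=
    fun i hi => hQ.lift_eq h (nlt i) hi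
  have e : ∀ x y, coneLT Q (pairZ x 0) (pairZ y 0) ↔ coneLT P x y := by
    intro x y
    rw [coneLT_pairZ, sub_zero, h, coneLT]
  have hz1 : coneLT Q (pairZ z 0) (pairZ 1 1) := coneLT_trans hQ.mem (hz0 z) hz₂
  have one_lt : coneLT Q (pairZ (1 : G) 0) (pairZ 1 1) := hQ.mono 1 one_pos
  -- the triple `(1, z, z²)` forces `z` to be positive for `P'`
  have hzP' : z ∈ P' := by
    by_contra hn
    have hn' : z⁻¹ ∈ P' := ((hP'.2 z).2 ((hP.2 z).1 (Or.inl hz))).resolve_left hn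
    have h₁ : hQ.circFun (1, z, z * z) = 1 := by
      have s0 := small 0 (by simpa using one_lt)
      have s1 := small 1 (by simpa using hz1)
      have s2 := small 2 (by simpa [sq] using hz₂)
      rw [pow_zero] at s0
      rw [pow_one] at s1
      rw [sq] at s2
      rw [circFun]
      simp only [s0, s1, s2]
      exact secretFun_of_lt (by simpa using hz0 1) (hz0 z)
    have l₁ : coneLT P' z 1 := by simpa [coneLT] using hn'
    have l₂ : coneLT P' (z * z) z := by simpa [coneLT] using hn'
    rw [← hc, ← secretFun_rotate, ← secretFun_rotate, secretFun_of_lt_swap hP' l₂ l₁] at h₁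
    exact absurd h₁ (by decide)
  -- the first power of `z` beyond `t` wraps around
  classical
  have hex : ∃ k, ¬ coneLT Q (pairZ (z ^ k) 0) (pairZ 1 1) := ⟨k, hk⟩
  set j := Nat.find hex with hj
  have hj0 := Nat.find_spec hex
  rw [← hj] at hj0
  obtain ⟨i, hi⟩ : ∃ i, j = i + 2 := by
    refine ⟨j - 2, ?_⟩
    have : j ≠ 0 := by
      intro h0
      rw [h0] at hj0
      exact hj0 (by simpa using one_lt)
    have : j ≠ 1 := by
      intro h0
      rw [h0] at hj0
      exact hj0 (by simpa using hz1)
    omega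
  have hlast : coneLT Q (pairZ (z ^ (i + 1)) 0) (pairZ 1 1) := by
    have := Nat.find_min hex (m := i + 1) (by omega)
    rwa [not_not] at this
  rw [hi] at hj0
  have hlt : coneLT Q (pairZ (z ^ (i + 2)) 0) (pairZ z 1) := by
    rw [coneLT_pairZ] at hlast ⊢
    simpa [pow_succ', mul_assoc] using hlast
  have hne : pairZ (z ^ (i + 2)) 0 ≠ pairZ 1 1 := by
    intro h'
    have : (0 : ℤ) = 1 := congrArg (fun p : G × Multiplicative ℤ => p.2.toAdd) h'
    omega
  have hgt : coneLT Q (pairZ 1 0) (pairZ (z ^ (i + 2)) (-1)) := by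
    simpa using (coneLT_pairZ_shift (-1)).2 ((coneLT_total hQ.mem hne).resolve_left hj0)
  have hlt' : coneLT Q (pairZ (z ^ (i + 2)) (-1)) (pairZ z 0) := by
    simpa using (coneLT_pairZ_shift (-1)).2 hlt
  have hlift : hQ.lift (z ^ (i + 2)) = pairZ (z ^ (i + 2)) (-1) := by
    rw [lift, hQ.level_unique (coneLT_asymm hQ.mem hgt) (coneLT_trans hQ.mem hlt' hz1)]
  have hzi : ¬ coneLT Q (pairZ (z ^ (i + 1)) 0) (pairZ z 0) := by
    rw [e]
    intro h'
    rcases i with _ | i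
    · exact coneLT_irrefl hP _ (by simpa using h')
    · exact coneLT_asymm hP h' (by simpa [add_comm, add_left_comm] using pw hP hz 1 i)
  have hlt'' : coneLT Q (pairZ (z ^ (i + 2)) (-1)) (pairZ (z ^ (i + 1)) 0) := by
    by_cases heq : pairZ (z ^ (i + 1)) 0 = pairZ z 0
    · rwa [heq]
    · exact coneLT_trans hQ.mem hlt' ((coneLT_total hQ.mem heq).resolve_left hzi)
  have h₂ : secretFun P' (1, z ^ (i + 1), z ^ (i + 2)) = 1 :=
    secretFun_of_lt (by simpa using pw hP' hzP' 0 i) (by simpa using pw hP' hzP' (i + 1) 0)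
  have s0 := small 0 (by simpa using one_lt)
  rw [pow_zero] at s0
  rw [hc, circFun] at h₂
  simp only [s0, small _ hlast, hlift] at h₂
  rw [secretFun_of_lt_swap hQ.mem hgt hlt''] at h₂
  exact absurd h₂ (by decide)

end IsCofinalCone

/-! ### Letting `t` act like `z ^ N`, and the limit as `N` grows -/

section RelativeCone

variable {G H : Type*} [Group G] [Group H]

/-- The cone in `G × ℤ` of the left-ordering in which the generator of `ℤ` acts like `z ^ N` on the
preordered quotient `H` of `G`, with ties broken by `P`. -/
def extendedCone (P : Set G) (π : G →* H) (R : Submonoid H) (z : H) (N : ℕ) :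
    Set (G × Multiplicative ℤ) :=
  {x | (π x.1 * z ^ (x.2.toAdd * N))⁻¹ ∉ R ∨ (π x.1 * z ^ (x.2.toAdd * N) ∈ R ∧ x.1 ∈ P)}

theorem mem_extendedCone {P : Set G} {π : G →* H} {R : Submonoid H} {z : H} {N : ℕ} {g : G}
    {n : ℤ} : pairZ g n ∈ extendedCone P π R z N ↔
      (π g * z ^ (n * N))⁻¹ ∉ R ∨ (π g * z ^ (n * N) ∈ R ∧ g ∈ P) := Iff.rfl

variable {P : Set G} {π : G →* H} {R : Submonoid H} {z : H}

theorem inv_notMem_of_zpow (hzR : z⁻¹ ∉ R) (hz : z ∈ R) {k : ℤ} (hk : 0 < k) :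
    (z ^ k)⁻¹ ∉ R := by
  intro h
  apply hzR
  obtain ⟨m, rfl⟩ : ∃ m : ℕ, k = m + 1 := ⟨(k - 1).toNat, by omega⟩
  have := R.mul_mem (R.pow_mem hz m) h
  rwa [zpow_add_one, mul_inv_rev, zpow_natCast, ← Commute.inv_inv (Commute.pow_self z m) |>.eq,
    mul_inv_cancel_left] at this

/-- Since `z` is central, `(g, n) ↦ π g * z ^ (n * N)` is a homomorphism, and the cone is
lexicographic: the preorder `R` first, then `P`. No tie is left undecided, because a nonzero power
of `z` is never equivalent to `1`. -/
theorem extendedCone_mem_leftOrderings (hP : P ∈ leftOrderings G)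
    (total : ∀ x, x ∈ R ∨ x⁻¹ ∈ R) (hz : ∀ x, Commute z x) (hzR : z⁻¹ ∉ R) {N : ℕ}
    (hN : 0 < N) :
    extendedCone P π R z N ∈ leftOrderings (G × Multiplicative ℤ) := by
  have hzR' : z ∈ R := (total z).resolve_right hzR
  constructor
  · rintro ⟨g, m⟩ hg ⟨h, n⟩ hh
    change (π g * z ^ (m.toAdd * N))⁻¹ ∉ R ∨ (π g * z ^ (m.toAdd * N) ∈ R ∧ g ∈ P) at hg
    change (π h * z ^ (n.toAdd * N))⁻¹ ∉ R ∨ (π h * z ^ (n.toAdd * N) ∈ R ∧ h ∈ P) at hh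
    change (π (g * h) * z ^ ((m.toAdd + n.toAdd) * N))⁻¹ ∉ R ∨
      (π (g * h) * z ^ ((m.toAdd + n.toAdd) * N) ∈ R ∧ g * h ∈ P)
    have e : π (g * h) * z ^ ((m.toAdd + n.toAdd) * N)
        = (π g * z ^ (m.toAdd * N)) * (π h * z ^ (n.toAdd * N)) := by
      rw [map_mul, add_mul, zpow_add, mul_assoc, mul_assoc, ← mul_assoc (z ^ _) (π h),
        ((hz (π h)).zpow_left _).eq, mul_assoc]
    rw [e]
    generalize π g * z ^ (m.toAdd * N) = x at hg ⊢
    generalize π h * z ^ (n.toAdd * N) = y at hh ⊢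
    have hx : x ∈ R := hg.elim (fun h => (total x).resolve_right h) (fun h => h.1)
    have hy : y ∈ R := hh.elim (fun h => (total y).resolve_right h) (fun h => h.1)
    rcases hg with hg | hg
    · refine Or.inl fun hxy => hg ?_
      simpa using R.mul_mem hy hxy
    rcases hh with hh | hh
    · refine Or.inl fun hxy => hh ?_
      simpa using R.mul_mem hxy hx
    · exact Or.inr ⟨R.mul_mem hx hy, hP.1 _ hg.2 _ hh.2⟩
  · rintro ⟨g, m⟩
    change (((π g * z ^ (m.toAdd * N))⁻¹ ∉ R ∨ (π g * z ^ (m.toAdd * N) ∈ R ∧ g ∈ P)) ∨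
      ((π g⁻¹ * z ^ (-m.toAdd * N))⁻¹ ∉ R ∨ (π g⁻¹ * z ^ (-m.toAdd * N) ∈ R ∧ g⁻¹ ∈ P))) ↔ _
    have e : π g⁻¹ * z ^ (-m.toAdd * N) = (π g * z ^ (m.toAdd * N))⁻¹ := by
      rw [mul_inv_rev, map_inv, neg_mul, zpow_neg]
      exact (((hz (π g)).zpow_left _).inv_inv.eq).symm
    rw [e, inv_inv]
    constructor
    · rintro h h'
      obtain ⟨rfl, rfl⟩ := Prod.mk.inj h'
      have : (1 : G) ∉ P := fun h1 => (hP.2 1).1 (Or.inl h1) rfl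
      simp [this] at h
    · intro h
      by_cases hx : π g * z ^ (m.toAdd * N) ∈ R
      · by_cases hx' : (π g * z ^ (m.toAdd * N))⁻¹ ∈ R
        · by_cases hg : g = 1
          · exfalso
            subst hg
            rw [map_one, one_mul] at hx hx'
            have hm : m.toAdd ≠ 0 := fun h0 => h (Prod.ext rfl h0)
            have hN' : (0 : ℤ) < N := by exact_mod_cast hN
            rcases lt_or_gt_of_ne hm with hm | hm
            · refine inv_notMem_of_zpow hzR hzR' (k := -m.toAdd * N)
                (mul_pos (by omega) hN') ?_
              rwa [neg_mul, zpow_neg, inv_inv]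
            · exact inv_notMem_of_zpow hzR hzR' (mul_pos hm hN') hx'
          · have := (hP.2 g).2 hg
            tauto
        · tauto
      · tauto

/-- The criterion that every family of groups is reduced to. The convergence is pointwise eventual
equality: by cofinality, the finitely many quotients of entries of a triple are all below `z ^ N`
for large `N`. -/
theorem exists_genuine_tendsto (hP : P ∈ leftOrderings G) (total : ∀ x, x ∈ R ∨ x⁻¹ ∈ R)
    (hPR : ∀ g ∈ P, π g ∈ R) (z : G) (hz : ∀ x, Commute (π z) x) (hzR : (π z)⁻¹ ∉ R)
    (cof : ∀ g, ∃ n : ℕ, (π g)⁻¹ * π z ^ n ∈ R) :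
    ∃ c : ℕ → circularOrderings G, (∀ k, c k ∈ genuineOrderings G) ∧
      Tendsto c atTop (𝓝 (secretOrdering ⟨P, hP⟩)) := by
  have hzR' : π z ∈ R := (total _).resolve_right hzR
  have hz1 : z ≠ 1 := by
    rintro rfl
    exact hzR (by simp)
  have hzP : z ∈ P := by
    refine ((hP.2 z).2 hz1).resolve_right fun h => hzR ?_
    rw [← map_inv]
    exact hPR _ h
  have lt_of : ∀ (N : ℕ) (g : G) (k : ℤ), (π g * (π z ^ (k * N))⁻¹) ∉ R →
      coneLT (extendedCone P π R (π z) N) (pairZ g 0) (pairZ 1 k) := by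
    intro N g k h
    rw [coneLT_pairZ, mul_one, sub_zero, mem_extendedCone]
    refine Or.inl ?_
    rwa [map_inv, mul_inv_rev, inv_inv, ((hz (π g)).zpow_left _).inv_left.eq]
  have notMem : ∀ (g : G) (n : ℕ), (π g)⁻¹ * π z ^ n ∈ R → ∀ k : ℤ, n < k →
      (π g * (π z ^ k)⁻¹) ∉ R := by
    intro g n hn k hk h
    have := R.mul_mem h hn
    rw [mul_assoc, ((hz ((π g)⁻¹ * π z ^ n)).zpow_left k).inv_left.eq, ← mul_assoc, ← mul_assoc,
      mul_inv_cancel, one_mul] at this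
    refine inv_notMem_of_zpow hzR hzR' (k := k - n) (by omega) ?_
    rwa [zpow_sub, mul_inv_rev, inv_inv, zpow_natCast]
  -- The shift by `3` keeps `z²` strictly below `t`, as genuineness requires.
  have hQ : ∀ N : ℕ, IsCofinalCone (extendedCone P π R (π z) (N + 3)) := by
    intro N
    refine ⟨extendedCone_mem_leftOrderings hP total hz hzR (by omega), ?_, fun g => ?_⟩
    · rw [mem_extendedCone]
      refine Or.inl ?_
      rw [map_one, one_mul]
      exact inv_notMem_of_zpow hzR hzR' (by positivity)
    · obtain ⟨n, hn⟩ := cof g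
      refine ⟨n + 1, lt_of _ _ _ (notMem g n hn _ ?_)⟩
      push_cast
      nlinarith
  have hQP : ∀ N : ℕ, ∀ g, pairZ g 0 ∈ extendedCone P π R (π z) (N + 3) ↔ g ∈ P := by
    intro N g
    rw [mem_extendedCone, zero_mul, zpow_zero, mul_one]
    constructor
    · rintro (h | h)
      · by_contra hg
        have hg1 : g ≠ 1 := by
          rintro rfl
          exact h (by simp)
        refine h ?_
        rw [← map_inv]
        exact hPR _ (((hP.2 g).2 hg1).resolve_left hg)
      · exact h.2
    · exact fun h => Or.inr ⟨hPR _ h, h⟩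
  refine ⟨fun N => (hQ N).circ, fun N => ?_, ?_⟩
  -- `t` acts like `z ^ (N + 3)`, so the next power of `z` is beyond it.
  · refine (hQ N).circ_mem_genuineOrderings hP (hQP N) hzP ?_ (k := N + 4) ?_
    · refine lt_of _ _ _ (notMem _ 2 (by simp [sq]) _ ?_)
      push_cast
      omega
    · rw [coneLT_pairZ, mul_one, sub_zero, mem_extendedCone, not_or, not_not]
      have e : (π (z ^ (N + 4))⁻¹ * π z ^ (1 * ((N + 3 : ℕ) : ℤ))) = (π z)⁻¹ := by
        rw [one_mul, zpow_natCast, map_inv, map_pow, pow_succ _ (N + 3), mul_inv_rev, mul_assoc,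
          inv_mul_cancel, mul_one]
      rw [e, inv_inv]
      exact ⟨hzR', fun h => hzR h.1⟩
  · rw [tendsto_subtype_rng, tendsto_pi_nhds]
    rintro ⟨a, b, c⟩
    set s : Set G := {a, b, c} with hs
    have hfin : (s ×ˢ s).Finite := (Set.toFinite s).prod (Set.toFinite s)
    choose f hf using fun p : G × G => cof (p.1⁻¹ * p.2)
    -- `B` bounds the exponents needed for all quotients of two entries of the triple.
    obtain ⟨B, hB⟩ := (hfin.image f).bddAbove
    refine tendsto_const_nhds.congr' ?_
    filter_upwards [eventually_ge_atTop B] with N hN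
    refine ((hQ N).circFun_eq_secretFun hP (hQP N) (s := s) (fun x hx y hy => ?_) ?_ ?_ ?_).symm
    · refine lt_of _ _ _ (notMem _ _ (hf (x, y)) _ ?_)
      have := hB (Set.mem_image_of_mem f (Set.mk_mem_prod hx hy))
      push_cast
      omega
    all_goals simp [hs]

end RelativeCone

/-! ### From sequences to density -/

section Conclusion

variable {G : Type*} [Group G]

theorem dense_and_accPt_of_exists_genuine_tendsto
    (h : ∀ P : leftOrderings G, ∃ c : ℕ → circularOrderings G,
      (∀ k, c k ∈ genuineOrderings G) ∧ Tendsto c atTop (𝓝 (secretOrdering P))) :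
    Dense (genuineOrderings G) ∧
      ∀ P : leftOrderings G,
        AccPt (secretOrdering P) (𝓟 (genuineOrderings G)) ∧
          ∃ c : ℕ → circularOrderings G, (∀ k, c k ∈ genuineOrderings G) ∧
            Tendsto c atTop (𝓝 (secretOrdering P)) := by
  have cl : ∀ P, secretOrdering P ∈ closure (genuineOrderings G) := by
    intro P
    obtain ⟨c, hc, hlim⟩ := h P
    exact mem_closure_of_tendsto hlim (Eventually.of_forall hc)
  refine ⟨fun c => ?_, fun P => ⟨?_, h P⟩⟩
  · by_cases hc : c ∈ genuineOrderings G
    · exact subset_closure hc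
    · obtain ⟨P, rfl⟩ := not_not.1 hc
      exact cl P
  · have hP : secretOrdering P ∉ genuineOrderings G := fun hn => hn ⟨P, rfl⟩
    rw [accPt_principal_iff_clusterPt, sdiff_singleton_eq_self hP]
    exact mem_closure_iff_clusterPt.1 (cl P)

end Conclusion

/-! ### Groups generated by roots of elements of a normal cyclic subgroup -/

section PeriodicGenerators

variable {G : Type*} [Group G] {P : Set G}

/-- The nonnegative elements of a left-ordered group. -/
def nonnegSubmonoid (hP : P ∈ leftOrderings G) : Submonoid G where
  carrier := {x | x = 1 ∨ x ∈ P}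
  one_mem' := Or.inl rfl
  mul_mem' := by
    rintro a b (rfl | ha) (rfl | hb)
    · simp
    · simp [hb]
    · simp [ha]
    · exact Or.inr (hP.1 _ ha _ hb)

theorem pow_mem_of_mem_leftOrderings (hP : P ∈ leftOrderings G) {g : G} (hg : g ∈ P) {k : ℕ}
    (hk : k ≠ 0) : g ^ k ∈ P := by
  obtain ⟨k, rfl⟩ := Nat.exists_eq_succ_of_ne_zero hk
  clear hk
  induction k with
  | zero => simpa using hg
  | succ k ih =>
    rw [pow_succ]
    exact hP.1 _ ih _ hg

theorem isMulTorsionFree_of_mem_leftOrderings (hP : P ∈ leftOrderings G) {g : G} {k : ℕ}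
    (hk : k ≠ 0) (h : g ^ k = 1) : g = 1 := by
  by_contra hg
  have h1 : (1 : G) ∉ P := fun h1 => (hP.2 1).1 (Or.inl h1) rfl
  rcases (hP.2 g).2 hg with hg | hg
  · exact h1 (h ▸ pow_mem_of_mem_leftOrderings hP hg hk)
  · have := pow_mem_of_mem_leftOrderings hP hg hk
    rw [inv_pow, h, inv_one] at this
    exact h1 this

theorem zpow_eq_one_of_mem_leftOrderings (hP : P ∈ leftOrderings G) {g : G} {k : ℤ}
    (hg : g ≠ 1) (h : g ^ k = 1) : k = 0 := by
  by_contra hk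
  refine hg (isMulTorsionFree_of_mem_leftOrderings hP (k := k.natAbs) (by omega) ?_)
  rw [← zpow_natCast]
  rcases Int.natAbs_eq k with hk | hk
  · rwa [← hk]
  · rw [hk, zpow_neg, inv_eq_one] at h
    exact h

/-- The elements that are bounded on both sides by powers of `z`, relative to a preorder. -/
def boundedSubgroup {H : Type*} [Group H] (π : G →* H) (R : Submonoid H) {z : H}
    (hz : ∀ x, Commute z x) : Subgroup G where
  carrier := {g | (∃ n : ℕ, (π g)⁻¹ * z ^ n ∈ R) ∧ ∃ n : ℕ, π g * z ^ n ∈ R}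
  one_mem' := ⟨⟨0, by simp⟩, ⟨0, by simp⟩⟩
  mul_mem' := by
    rintro a b ⟨⟨m, hm⟩, ⟨m', hm'⟩⟩ ⟨⟨n, hn⟩, ⟨n', hn'⟩⟩
    refine ⟨⟨n + m, ?_⟩, ⟨m' + n', ?_⟩⟩
    · have := R.mul_mem hn hm
      rwa [mul_assoc, ((hz _).pow_left n).eq, mul_assoc, ← pow_add, ← mul_assoc, ← mul_inv_rev,
        ← map_mul, add_comm] at this
    · have := R.mul_mem hm' hn'
      rwa [mul_assoc, ((hz _).pow_left m').eq, mul_assoc, ← pow_add, ← mul_assoc,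
        ← map_mul, add_comm] at this
  inv_mem' := by
    rintro a ⟨h₁, h₂⟩
    rw [mem_ofPred_eq, map_inv, inv_inv]
    exact ⟨h₂, h₁⟩

/-- A left-ordered group that is generated by elements with a positive power in a cyclic normal
subgroup has a central cofinal element. -/
theorem exists_genuine_tendsto_of_periodic [Nontrivial G] {S : Set G}
    (hS : Subgroup.closure S = ⊤) {h : G} (hnorm : ∀ g : G, g * h * g⁻¹ ∈ Subgroup.zpowers h)
    (hpow : ∀ s ∈ S, ∃ k : ℕ, k ≠ 0 ∧ s ^ k ∈ Subgroup.zpowers h) (hP : P ∈ leftOrderings G) :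
    ∃ c : ℕ → circularOrderings G, (∀ k, c k ∈ genuineOrderings G) ∧
      Tendsto c atTop (𝓝 (secretOrdering ⟨P, hP⟩)) := by
  have hh : h ≠ 1 := by
    rintro rfl
    have : Subgroup.closure S ≤ ⊥ := by
      rw [Subgroup.closure_le]
      intro s hs
      obtain ⟨k, hk, hs⟩ := hpow s hs
      rw [Subgroup.zpowers_one_eq_bot, Subgroup.mem_bot] at hs
      exact isMulTorsionFree_of_mem_leftOrderings hP hk hs
    rw [hS, top_le_iff] at this
    exact bot_ne_top this
  have hinj : ∀ {m n : ℤ}, h ^ m = h ^ n → m = n := by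
    intro m n hmn
    have := zpow_eq_one_of_mem_leftOrderings hP (k := m - n) hh (by rw [zpow_sub, hmn, mul_inv_cancel])
    omega
  -- If `s h s⁻¹ = h ^ j` and `s ^ k = h ^ n`, then conjugating `h ^ n` by `s` gives `h ^ (j n) = h
  -- ^ n`. Hence `j = 1`, or `n = 0` and `s = 1` by torsion-freeness.
  have hcent : ∀ g, Commute h g := by
    suffices hle : Subgroup.closure S ≤ Subgroup.centralizer {h} by
      intro g
      have hg : g ∈ Subgroup.centralizer {h} := hle (hS ▸ Subgroup.mem_top g)
      exact Subgroup.mem_centralizer_iff.1 hg h rfl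
    rw [Subgroup.closure_le]
    intro s hs
    rw [SetLike.mem_coe, Subgroup.mem_centralizer_iff]
    intro m hm
    rw [Set.mem_singleton_iff.1 hm]
    obtain ⟨k, hk, n, hn⟩ := hpow s hs
    obtain ⟨j, hj⟩ := hnorm s
    simp only at hn hj
    have h₁ : h ^ (j * n) = h ^ n := by
      rw [zpow_mul, hj, conj_zpow, hn, ← pow_succ', pow_succ, mul_inv_cancel_right]
    have h₂ : (j - 1) * n = 0 := by linarith [hinj h₁]
    rcases mul_eq_zero.1 h₂ with h₃ | rfl
    · obtain rfl : j = 1 := by omega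
      rw [zpow_one, eq_mul_inv_iff_mul_eq] at hj
      exact hj
    · rw [zpow_zero] at hn
      rw [isMulTorsionFree_of_mem_leftOrderings hP hk hn.symm]
      simp
  obtain ⟨z, hzP, hz, hzpow⟩ : ∃ z ∈ P, (∀ g, Commute z g) ∧
      ∀ s ∈ S, ∃ k : ℕ, k ≠ 0 ∧ ∃ n : ℤ, z ^ n = s ^ k := by
    rcases (hP.2 h).2 hh with hp | hp
    · exact ⟨h, hp, hcent, hpow⟩
    · refine ⟨h⁻¹, hp, fun g => (hcent g).inv_left, fun s hs => ?_⟩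
      obtain ⟨k, hk, n, hn⟩ := hpow s hs
      exact ⟨k, hk, -n, by simpa using hn⟩
  have hz1 : z ≠ 1 := (hP.2 z).1 (Or.inl hzP)
  set R := nonnegSubmonoid hP
  have total : ∀ x, x ∈ R ∨ x⁻¹ ∈ R := by
    intro x
    by_cases hx : x = 1
    · exact Or.inl (Or.inl hx)
    · exact ((hP.2 x).2 hx).imp Or.inr Or.inr
  have hzR : z⁻¹ ∉ R := by
    rintro (h' | h')
    · exact hz1 (inv_eq_one.1 h')
    · have := hP.1 _ hzP _ h'
      rw [mul_inv_cancel] at this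
      exact (hP.2 1).1 (Or.inl this) rfl
  refine exists_genuine_tendsto (π := MonoidHom.id G) (R := R) hP total (fun g hg => Or.inr hg) z
    hz hzR ?_
  have hle : Subgroup.closure S ≤ boundedSubgroup (MonoidHom.id G) R hz := by
    rw [Subgroup.closure_le]
    have key : ∀ (s : G) (k : ℕ) (n : ℤ), k ≠ 0 → z ^ n = s ^ k → ∃ m : ℕ, s⁻¹ * z ^ m ∈ R := by
      intro s k n hk hn
      -- With `m = |n| + 1`, failure would make `z ^ (-m) s` nonnegative, hence also its `k`-th
      -- power `z ^ (-m k + n)`, whose exponent is negative.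
      refine ⟨n.natAbs + 1, ?_⟩
      by_contra hcon
      have h₁ := R.pow_mem ((total _).resolve_left hcon) k
      rw [mul_inv_rev, inv_inv, ((hz s).pow_left _).inv_left.mul_pow, ← hn, ← zpow_natCast,
        ← zpow_natCast, ← zpow_neg, ← zpow_mul, ← zpow_add] at h₁
      have h₂ : 0 < -(-((n.natAbs + 1 : ℕ) : ℤ) * k + n) := by
        have : (1 : ℤ) ≤ k := by omega
        push_cast
        nlinarith [le_abs_self n, abs_nonneg n]
      refine inv_notMem_of_zpow hzR (Or.inr hzP) h₂ ?_
      rwa [← zpow_neg, neg_neg]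
    intro s hs
    obtain ⟨k, hk, n, hn⟩ := hzpow s hs
    refine ⟨key s k n hk hn, ?_⟩
    simpa using key s⁻¹ k (-n) hk (by rw [zpow_neg, hn, inv_pow])
  intro g
  exact (hle (hS ▸ Subgroup.mem_top g)).1

end PeriodicGenerators

/-! ### Finitely generated nilpotent groups -/

section Nilpotent

variable {G : Type*} [Group G] {P : Set G}

/-- A subgroup is convex for the left-ordering with cone `P` if it contains everything that lies
between `1` and one of its elements. -/
def IsConvexSubgroup (P : Set G) (C : Subgroup G) : Prop :=
  ∀ x ∈ P, ∀ c ∈ C, x⁻¹ * c ∈ P → x ∈ C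

namespace IsConvexSubgroup

variable (hP : P ∈ leftOrderings G) {C : Subgroup G} (hC : IsConvexSubgroup P C)
include hP hC

/-- A positive element outside a convex subgroup lies above the whole subgroup. With its mirror
image, this makes `C ∪ P` a submonoid. -/
theorem mul_mem_right {x c : G} (hx : x ∈ P) (hxC : x ∉ C) (hc : c ∈ C) : x * c ∈ P := by
  by_contra h
  have hne : x * c ≠ 1 := by
    intro h1
    rw [mul_eq_one_iff_eq_inv] at h1
    exact hxC (h1 ▸ C.inv_mem hc)
  have h₁ := ((hP.2 _).2 hne).resolve_left h
  rw [mul_inv_rev] at h₁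
  have h₂ := hC _ h₁ _ (C.inv_mem hc) (by simpa using hx)
  apply hxC
  simpa using (C.mul_mem_cancel_left (C.inv_mem hc)).1 h₂

theorem mul_mem_left {x c : G} (hx : x ∈ P) (hxC : x ∉ C) (hc : c ∈ C) : c * x ∈ P := by
  by_contra h
  have hne : c * x ≠ 1 := by
    intro h1
    rw [mul_eq_one_iff_eq_inv'] at h1
    exact hxC (h1 ▸ C.inv_mem hc)
  have h₁ := ((hP.2 _).2 hne).resolve_left h
  rw [mul_inv_rev] at h₁
  exact hxC (hC _ hx _ (C.inv_mem hc) h₁)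

end IsConvexSubgroup

/-- Zorn's lemma applies because the union of a chain of proper subgroups is proper: otherwise one
member would already contain a finite generating set. -/
theorem exists_maximal_isConvexSubgroup [Nontrivial G] (hfg : Group.FG G)
    (hP : P ∈ leftOrderings G) :
    ∃ C : Subgroup G, IsConvexSubgroup P C ∧ C ≠ ⊤ ∧
      ∀ D, IsConvexSubgroup P D → C ≤ D → D ≠ C → D = ⊤ := by
  obtain ⟨T, hT, hTfin⟩ := Group.fg_iff.1 hfg
  have hbot : IsConvexSubgroup P (⊥ : Subgroup G) := by
    intro x hx c hc hxc
    rw [Subgroup.mem_bot] at hc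
    subst hc
    have := hP.1 _ hx _ hxc
    rw [mul_one, mul_inv_cancel] at this
    exact absurd rfl ((hP.2 1).1 (Or.inl this))
  obtain ⟨C, -, hC⟩ := zorn_le_nonempty₀ {C : Subgroup G | IsConvexSubgroup P C ∧ C ≠ ⊤} (by
    intro c hc hchain C₀ hC₀
    have hmem : ∀ {x}, x ∈ sSup c ↔ ∃ D ∈ c, x ∈ D := fun {x} =>
      Subgroup.mem_sSup_of_directedOn ⟨C₀, hC₀⟩ hchain.directedOn
    refine ⟨sSup c, ⟨?_, ?_⟩, fun D hD => le_sSup hD⟩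
    · intro x hx d hd hxd
      obtain ⟨D, hD, hdD⟩ := hmem.1 hd
      exact hmem.2 ⟨D, hD, (hc hD).1 x hx d hdD hxd⟩
    · intro htop
      obtain ⟨D, hD, hTD⟩ : ∃ D ∈ c, T ⊆ D := by
        have hdir : DirectedOn (· ⊆ ·) ((fun D : Subgroup G => (D : Set G)) '' c) := by
          rintro _ ⟨D, hD, rfl⟩ _ ⟨E, hE, rfl⟩
          obtain ⟨F, hF, hDF, hEF⟩ := hchain.directedOn D hD E hE
          exact ⟨F, ⟨F, hF, rfl⟩, hDF, hEF⟩
        obtain ⟨_, ⟨D, hD, rfl⟩, hTD⟩ := hdir.exists_mem_subset_of_finite_of_subset_sUnion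
          (Set.Nonempty.image _ ⟨C₀, hC₀⟩) hTfin (fun t _ => by
            obtain ⟨D, hD, ht⟩ := hmem.1 (htop ▸ Subgroup.mem_top t)
            exact Set.mem_sUnion.2 ⟨_, Set.mem_image_of_mem _ hD, ht⟩)
        exact ⟨D, hD, hTD⟩
      refine (hc hD).2 (top_le_iff.1 ?_)
      rw [← hT, Subgroup.closure_le]
      exact hTD) ⊥ ⟨hbot, bot_ne_top⟩
  refine ⟨C, hC.prop.1, hC.prop.2, fun D hD hCD hne => ?_⟩
  by_contra hD'
  exact hne (le_antisymm (hC.le_of_ge ⟨hD, hD'⟩ hCD) hCD)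

theorem exists_genuine_tendsto_of_nilpotent [Nontrivial G] (hfg : Group.FG G)
    [Group.IsNilpotent G] (hP : P ∈ leftOrderings G) :
    ∃ c : ℕ → circularOrderings G, (∀ k, c k ∈ genuineOrderings G) ∧
      Tendsto c atTop (𝓝 (secretOrdering ⟨P, hP⟩)) := by
  obtain ⟨C, hC, hCtop, hmax⟩ := exists_maximal_isConvexSubgroup hfg hP
  set K := C.normalCore
  have hKC : K ≤ C := C.normalCore_le
  have : Nontrivial (G ⧸ K) := by
    rw [QuotientGroup.nontrivial_iff]
    exact fun h => hCtop (top_le_iff.1 (h ▸ hKC))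
  set π := QuotientGroup.mk' K
  have hπ : ∀ {a b}, π a = π b ↔ a⁻¹ * b ∈ K := QuotientGroup.eq
  obtain ⟨z, hzP, hzC, hz⟩ : ∃ z ∈ P, z ∉ C ∧ ∀ x, Commute (π z) x := by
    obtain ⟨⟨x, hx⟩, hx1⟩ := Subgroup.ne_bot_iff_exists_ne_one.1
      (Group.IsNilpotent.center_ne_bot (G := G ⧸ K))
    obtain ⟨z, rfl⟩ := QuotientGroup.mk'_surjective K x
    have hcomm : ∀ x, Commute (π z) x := fun x => (Subgroup.mem_center_iff.1 hx x).symm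
    -- Modulo `K` every conjugate of `z` equals `z`. If `z` were in `C`, all its conjugates would be
    -- too, and `z` would lie in the normal core.
    have hzC : z ∉ C := by
      intro hzC
      apply hx1
      rw [Subtype.ext_iff]
      refine (QuotientGroup.eq_one_iff z).2 fun g => ?_
      have h₁ : π z = π (g * z * g⁻¹) := by
        rw [map_mul, map_mul, map_inv, ← (hcomm (π g)).eq, mul_inv_cancel_right]
      have h₂ := hKC (hπ.1 h₁)
      exact (C.mul_mem_cancel_left (C.inv_mem hzC)).1 h₂
    have hz1 : z ≠ 1 := by
      rintro rfl
      exact hzC C.one_mem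
    rcases (hP.2 z).2 hz1 with h | h
    · exact ⟨z, h, hzC, hcomm⟩
    · exact ⟨z⁻¹, h, by simpa using hzC, fun x => by simpa using (hcomm x).inv_left⟩
  let R₀ : Submonoid G :=
    { carrier := {x | x ∈ C ∨ x ∈ P}
      one_mem' := Or.inl C.one_mem
      mul_mem' := by
        intro a b ha hb
        by_cases haC : a ∈ C <;> by_cases hbC : b ∈ C
        · exact Or.inl (C.mul_mem haC hbC)
        · exact Or.inr (hC.mul_mem_left hP (hb.resolve_left hbC) hbC haC)
        · exact Or.inr (hC.mul_mem_right hP (ha.resolve_left haC) haC hbC)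
        · exact Or.inr (hP.1 _ (ha.resolve_left haC) _ (hb.resolve_left hbC)) }
  set R := R₀.map π
  have memR : ∀ g, g ∈ C ∨ g ∈ P → π g ∈ R := fun g hg => ⟨g, hg, rfl⟩
  have total : ∀ x, x ∈ R ∨ x⁻¹ ∈ R := by
    intro x
    obtain ⟨g, rfl⟩ := QuotientGroup.mk'_surjective K x
    by_cases hg : g = 1
    · exact Or.inl (memR _ (Or.inl (hg ▸ C.one_mem)))
    · rw [← map_inv]
      exact ((hP.2 g).2 hg).imp (fun h => memR _ (Or.inr h)) (fun h => memR _ (Or.inr h))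
  -- Since `K ≤ C`, a factor from `K` does not affect positivity outside `C`; so the strict part of
  -- the preorder survives in `G ⧸ K`.
  have hzR : (π z)⁻¹ ∉ R := by
    rintro ⟨g, hg, hgz⟩
    rw [← map_inv, hπ] at hgz
    have hgC : g ∉ C := by
      intro hgC
      have := (C.mul_mem_cancel_left (C.inv_mem hgC)).1 (hKC hgz)
      exact hzC (by simpa using this)
    have h₁ := hC.mul_mem_right hP (hg.resolve_left hgC) hgC (hKC hgz)
    rw [mul_inv_cancel_left] at h₁
    have h₂ := hP.1 _ hzP _ h₁
    rw [mul_inv_cancel] at h₂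
    exact (hP.2 1).1 (Or.inl h₂) rfl
  refine exists_genuine_tendsto (π := π) (R := R) hP total (fun g hg => memR g (Or.inr hg)) z
    hz hzR ?_
  -- The elements bounded by powers of `z` form a convex subgroup containing `C` and `z`, so by
  -- maximality of `C` it is everything.
  have hD : boundedSubgroup π R hz = ⊤ := by
    refine hmax _ ?_ ?_ ?_
    · rintro x hx c ⟨⟨n, hn⟩, -⟩ hxc
      refine ⟨⟨n, ?_⟩, ⟨0, ?_⟩⟩
      · have := R.mul_mem (memR _ (Or.inr hxc)) hn
        rwa [map_mul, map_inv, mul_assoc, mul_inv_cancel_left] at this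
      · rw [pow_zero, mul_one]
        exact memR _ (Or.inr hx)
    · intro c hc
      refine ⟨⟨0, ?_⟩, ⟨0, ?_⟩⟩
      · rw [pow_zero, mul_one, ← map_inv]
        exact memR _ (Or.inl (C.inv_mem hc))
      · rw [pow_zero, mul_one]
        exact memR _ (Or.inl hc)
    · intro h
      apply hzC
      rw [← h]
      refine ⟨⟨1, by simp⟩, ⟨0, ?_⟩⟩
      rw [pow_zero, mul_one]
      exact memR _ (Or.inr hzP)
  intro g
  have hg : g ∈ boundedSubgroup π R hz := hD ▸ Subgroup.mem_top g
  exact hg.1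

end Nilpotent

/-! ### Braid groups: two generators with a common central power -/

namespace BraidGroup

variable {n : ℕ}

/-- The standard generator `σ_i` of the braid group on `n` strands, and `1` if `i` is too large. -/
def gen (n i : ℕ) : BraidGroup n :=
  if h : i < n - 1 then PresentedGroup.of ⟨i, h⟩ else 1

/-- The product `σ_a σ_{a+1} ⋯ σ_{a+k-1}`. -/
def run (n a k : ℕ) : BraidGroup n := ((List.range' a k).map (gen n)).prod

theorem run_succ (a k : ℕ) : run n a (k + 1) = gen n a * run n (a + 1) k := by
  simp [run, List.range'_succ]

theorem run_add (a k l : ℕ) : run n a (k + l) = run n a k * run n (a + k) l := by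
  induction k generalizing a with
  | zero => simp [run]
  | succ k ih =>
    rw [show k + 1 + l = (k + l) + 1 by omega, run_succ, run_succ, ih, mul_assoc,
      show a + 1 + k = a + (k + 1) by omega]

theorem gen_comm {i j : ℕ} (h : i + 1 < j) : gen n i * gen n j = gen n j * gen n i := by
  by_cases hj : j < n - 1
  · have hi : i < n - 1 := by omega
    rw [gen, gen, dif_pos hi, dif_pos hj]
    have := PresentedGroup.one_of_mem (rels := braidRels n)
      (Or.inl ⟨⟨i, hi⟩, ⟨j, hj⟩, h, rfl⟩)
    rw [map_mul, map_inv, mul_inv_eq_one] at this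
    exact this
  · simp [gen, hj]

theorem gen_braid {i : ℕ} (h : i + 1 < n - 1) :
    gen n i * gen n (i + 1) * gen n i = gen n (i + 1) * gen n i * gen n (i + 1) := by
  have hi : i < n - 1 := by omega
  rw [gen, gen, dif_pos hi, dif_pos h]
  have := PresentedGroup.one_of_mem (rels := braidRels n)
    (Or.inr ⟨⟨i, hi⟩, ⟨i + 1, h⟩, rfl, rfl⟩)
  rw [map_mul, map_inv, mul_inv_eq_one] at this
  exact this

theorem commute_gen_run_right {i a k : ℕ} (h : i + 1 < a) : Commute (gen n i) (run n a k) := by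
  induction k generalizing a with
  | zero => simp [run]
  | succ k ih =>
    rw [run_succ]
    exact Commute.mul_right (gen_comm h) (ih (by omega))

theorem commute_gen_run_left {i a k : ℕ} (h : a + k < i + 1) (ha : a + k ≤ i + 1) :
    Commute (gen n (i + 1)) (run n a k) := by
  induction k generalizing a with
  | zero => simp [run]
  | succ k ih =>
    rw [run_succ]
    exact Commute.mul_right (gen_comm (by omega)).symm (ih (by omega) (by omega))

/-- The product of all the generators. -/
abbrev delta (n : ℕ) : BraidGroup n := run n 0 (n - 1)

/-- In `delta n`, only the factors `σ_i σ_{i+1}` interact: `σ_i` commutes past the later ones, the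
braid relation turns it into `σ_{i+1}`, and this commutes past the earlier ones. -/
theorem delta_mul_gen {i : ℕ} (h : i + 1 < n - 1) :
    delta n * gen n i = gen n (i + 1) * delta n := by
  obtain ⟨l, hl⟩ : ∃ l, n - 1 = i + (2 + l) := ⟨n - 1 - i - 2, by omega⟩
  have h₂ : run n i 2 = gen n i * gen n (i + 1) := by simp [run, List.range'_succ]
  have hd : delta n = run n 0 i * (gen n i * gen n (i + 1) * run n (i + 2) l) := by
    rw [delta, congrArg (run n 0) hl, run_add, run_add, zero_add, h₂]
  rw [hd]
  have c₁ := commute_gen_run_right (n := n) (i := i) (a := i + 2) (k := l) (by omega)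
  have c₂ := commute_gen_run_left (n := n) (i := i) (a := 0) (k := i) (by omega) (by omega)
  have b := gen_braid h
  calc run n 0 i * (gen n i * gen n (i + 1) * run n (i + 2) l) * gen n i
      = run n 0 i * (gen n i * gen n (i + 1) * gen n i) * run n (i + 2) l := by
        simp only [mul_assoc, c₁.eq]
    _ = run n 0 i * gen n (i + 1) * (gen n i * gen n (i + 1) * run n (i + 2) l) := by
        rw [b]; simp only [mul_assoc]
    _ = _ := by rw [← c₂.eq]; simp only [mul_assoc]

/-- The product of the first generator and all the generators. -/
abbrev epsilon (n : ℕ) : BraidGroup n := gen n 0 * delta n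

theorem gen_eq_conj {i : ℕ} (h : i < n - 1) :
    gen n i = delta n ^ i * gen n 0 * (delta n ^ i)⁻¹ := by
  induction i with
  | zero => simp
  | succ i ih =>
    rw [pow_succ', mul_inv_rev, ← mul_inv_eq_iff_eq_mul.2 (delta_mul_gen h), ih (by omega)]
    simp only [mul_assoc]

/-- Each new `σ_0`, moved left across `δ ^ k`, becomes `σ_k` and extends the run. At `k = n - 1` the
run is `δ` itself, whence `ε ^ (n - 1) = δ ^ n`. -/
theorem epsilon_pow {k : ℕ} (h : k ≤ n - 1) : epsilon n ^ k = run n 0 k * delta n ^ k := by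
  induction k with
  | zero => simp [run]
  | succ k ih =>
    have h₁ : run n 0 (k + 1) = run n 0 k * gen n k := by
      rw [run_add, zero_add]
      simp [run]
    rw [pow_succ, ih (by omega), h₁, gen_eq_conj (by omega), pow_succ, epsilon]
    simp only [mul_assoc, inv_mul_cancel_left]

theorem epsilon_pow_eq_delta_pow (hn : 1 ≤ n) : epsilon n ^ (n - 1) = delta n ^ n := by
  rw [epsilon_pow le_rfl, ← pow_succ', Nat.sub_add_cancel hn]

theorem closure_delta_epsilon : Subgroup.closure {delta n, epsilon n} = ⊤ := by
  set H := Subgroup.closure {delta n, epsilon n}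
  have hd : delta n ∈ H := Subgroup.subset_closure (by simp)
  have he : epsilon n ∈ H := Subgroup.subset_closure (by simp)
  have h0 : gen n 0 ∈ H := (H.mul_mem_cancel_right hd).1 he
  rw [eq_top_iff, ← PresentedGroup.closure_range_of, Subgroup.closure_le]
  rintro _ ⟨i, rfl⟩
  have : PresentedGroup.of i = gen n i := by simp [gen]
  rw [this, gen_eq_conj i.2]
  exact H.mul_mem (H.mul_mem (H.pow_mem hd _) h0) (H.inv_mem (H.pow_mem hd _))

theorem delta_pow_mem_center (hn : 1 ≤ n) : delta n ^ n ∈ Subgroup.center (BraidGroup n) := by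
  have : (⊤ : Subgroup (BraidGroup n)) ≤ Subgroup.centralizer {delta n ^ n} := by
    rw [← closure_delta_epsilon, Subgroup.closure_le]
    rintro x (rfl | rfl) y hy <;> rw [Set.mem_singleton_iff.1 hy]
    · exact (Commute.self_pow _ _).symm
    · rw [← epsilon_pow_eq_delta_pow hn]
      exact (Commute.self_pow _ _).symm
  rw [Subgroup.mem_center_iff]
  intro g
  exact (this (Subgroup.mem_top g) _ rfl).symm

end BraidGroup

theorem exists_genuine_tendsto_of_braid {G : Type*} [Group G] [Nontrivial G] {n : ℕ}
    (e : G ≃* BraidGroup n) {P : Set G} (hP : P ∈ leftOrderings G) :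
    ∃ c : ℕ → circularOrderings G, (∀ k, c k ∈ genuineOrderings G) ∧
      Tendsto c atTop (𝓝 (secretOrdering ⟨P, hP⟩)) := by
  -- The exponents `n` and `n - 1` must be nonzero; for smaller `n` the group is trivial.
  have hn : 2 ≤ n := by
    by_contra! hn
    obtain ⟨a, b, hab⟩ := exists_pair_ne G
    have : IsEmpty (Fin (n - 1)) := by
      rw [show n - 1 = 0 by omega]
      infer_instance
    have htop : (⊤ : Subgroup (BraidGroup n)) = ⊥ := by
      rw [← PresentedGroup.closure_range_of, range_eq_empty, Subgroup.closure_empty]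
    have triv : ∀ x : BraidGroup n, x = 1 := fun x => by
      rw [← Subgroup.mem_bot, ← htop]
      exact Subgroup.mem_top x
    exact hab (e.injective ((triv _).trans (triv _).symm))
  set z := e.symm (BraidGroup.delta n ^ n) with hz
  refine exists_genuine_tendsto_of_periodic
    (S := e.symm '' {BraidGroup.delta n, BraidGroup.epsilon n}) (h := z) ?_ ?_ ?_ hP
  · have := MonoidHom.map_closure e.symm.toMonoidHom {BraidGroup.delta n, BraidGroup.epsilon n}
    rw [BraidGroup.closure_delta_epsilon, ← MonoidHom.range_eq_map,
      MonoidHom.range_eq_top.2 e.symm.surjective] at this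
    exact this.symm
  · intro g
    have h₁ := Subgroup.mem_center_iff.1 (BraidGroup.delta_pow_mem_center (n := n) (by omega)) (e g)
    have h₂ : g * z = z * g := by
      apply e.injective
      simpa [hz] using h₁
    rw [h₂, mul_inv_cancel_right]
    exact Subgroup.mem_zpowers z
  · rintro _ ⟨x, rfl | rfl, rfl⟩
    · exact ⟨n, by omega, by rw [← map_pow]; exact Subgroup.mem_zpowers z⟩
    · refine ⟨n - 1, by omega, ?_⟩
      rw [← map_pow, BraidGroup.epsilon_pow_eq_delta_pow (by omega)]
      exact Subgroup.mem_zpowers z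

/-! ### Path classes, cocycles and van Kampen gluing -/

section PathClasses

open Path.Homotopic unitInterval

variable {X : Type*} [TopologicalSpace X]

/-- A property of path classes that is stable under composition holds for a path if it holds for
all short pieces of it. -/
theorem Path.Homotopic.Quotient.induction_of_open_cover {ι : Type*} {V : ι → Set X}
    (hV : ∀ i, IsOpen (V i)) {Q : ∀ ⦃x y : X⦄, Path.Homotopic.Quotient x y → Prop}
    (trans : ∀ {x y z : X} (p : Path.Homotopic.Quotient x y) (q : Path.Homotopic.Quotient y z),
      Q p → Q q → Q (p.trans q))
    {x y : X} (u : Path x y) (hu : ∀ t, ∃ i, u t ∈ V i)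
    (loc : ∀ {a b : X} (w : Path a b) (i : ι), range w ⊆ V i → range w ⊆ range u →
      Q (Path.Homotopic.Quotient.mk w)) :
    Q (Path.Homotopic.Quotient.mk u) := by
  obtain ⟨t, ht0, hmono, ⟨n, hn⟩, hsub⟩ := exists_monotone_Icc_subset_open_cover_unitInterval
    (c := fun i => u ⁻¹' V i) (fun i => (hV i).preimage u.continuous)
    (fun s _ => mem_iUnion.2 (hu s))
  have piece : ∀ {a b : I} {i : ι}, a ≤ b → Icc a b ⊆ u ⁻¹' V i →
      Q (Path.Homotopic.Quotient.mk (u.subpath a b)) := by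
    intro a b i hab h
    refine loc _ i ?_ ?_ <;> rw [Path.range_subpath_of_le _ _ _ hab]
    · rintro _ ⟨s, hs, rfl⟩
      exact h hs
    · exact image_subset_range _ _
  have main : ∀ k, Q (Path.Homotopic.Quotient.mk (u.subpath 0 (t k))) := by
    intro k
    induction k with
    | zero =>
      obtain ⟨i, hi⟩ := hsub 0
      rw [ht0]
      refine piece (i := i) le_rfl (subset_trans (Icc_subset_Icc ht0.le ?_) hi)
      rw [← ht0]
      exact hmono (Nat.le_succ 0)
    | succ k ih =>
      obtain ⟨i, hi⟩ := hsub k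
      have h := trans _ _ ih (piece (hmono k.le_succ) hi)
      rw [← Path.Homotopic.Quotient.mk_trans,
        Path.Homotopic.Quotient.eq.2 ⟨Path.Homotopy.subpathTransSubpath u 0 (t k) (t (k + 1))⟩] at h
      exact h
  have hcast : ∀ {a b a' b' : X} (p : Path a b) (ha : a' = a) (hb : b' = b),
      Q (Path.Homotopic.Quotient.mk (p.cast ha hb)) → Q (Path.Homotopic.Quotient.mk p) := by
    rintro a b _ _ p rfl rfl h
    exact h
  have := main n
  rw [hn n le_rfl, Path.subpath_zero_one] at this
  exact hcast _ _ _ this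

/-- Conjugation by a path class. -/
noncomputable def pathConj {x y : X} (q : Path.Homotopic.Quotient x y) :
    FundamentalGroup X y →* FundamentalGroup X x where
  toFun g := FundamentalGroup.fromPath (q.trans ((FundamentalGroup.toPath g).trans q.symm))
  map_one' := by
    change q.trans ((Path.Homotopic.Quotient.refl y).trans q.symm) = Path.Homotopic.Quotient.refl x
    simp
  map_mul' g h := by
    change q.trans ((Path.Homotopic.Quotient.trans h g).trans q.symm) =
      (q.trans (Path.Homotopic.Quotient.trans h q.symm)).trans
        (q.trans (Path.Homotopic.Quotient.trans g q.symm))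
    grind

theorem pathConj_apply {x y : X} (q : Path.Homotopic.Quotient x y) (g : FundamentalGroup X y) :
    pathConj q g = q.trans (Path.Homotopic.Quotient.trans g q.symm) := rfl

theorem pathConj_trans {x y z : X} (p : Path.Homotopic.Quotient x y)
    (q : Path.Homotopic.Quotient y z) (g : FundamentalGroup X z) :
    pathConj (p.trans q) g = pathConj p (pathConj q g) := by
  simp only [pathConj_apply]
  have : (p.trans q).symm = q.symm.trans p.symm := by
    induction p with | mk p =>
    induction q with | mk q =>
    rw [← Path.Homotopic.Quotient.mk_trans, ← Path.Homotopic.Quotient.mk_symm, Path.trans_symm]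
    rfl
  rw [this]
  grind

/-- The product in `FundamentalGroup` composes paths from right to left, so the inverse ends up on
the left. -/
theorem pathConj_self {x : X} (q g : FundamentalGroup X x) :
    pathConj (FundamentalGroup.toPath q) g = q⁻¹ * g * q := by
  rw [pathConj_apply, FundamentalGroup.mul_def, FundamentalGroup.mul_def,
    FundamentalGroup.inv_def]

/-- A function on path classes with values in a group that reverses composition. -/
structure PathCocycle (X : Type*) [TopologicalSpace X] (K : Type*) [Group K] where
  /-- The value of the cocycle on a path class. -/
  val : ∀ ⦃x y : X⦄, Path.Homotopic.Quotient x y → K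
  val_trans : ∀ {x y z : X} (p : Path.Homotopic.Quotient x y) (q : Path.Homotopic.Quotient y z),
    val (p.trans q) = val q * val p

namespace PathCocycle

variable {K : Type*} [Group K] (v : PathCocycle X K)

theorem val_refl (x : X) : v.val (Path.Homotopic.Quotient.refl x) = 1 := by
  have := v.val_trans (Path.Homotopic.Quotient.refl x) (Path.Homotopic.Quotient.refl x)
  simpa using this

theorem val_symm {x y : X} (p : Path.Homotopic.Quotient x y) : v.val p.symm = (v.val p)⁻¹ := by
  have := v.val_trans p p.symm
  rw [Path.Homotopic.Quotient.trans_symm, val_refl] at this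
  exact eq_inv_of_mul_eq_one_left this.symm

/-- The cocycle vanishes on the loops in `W`. -/
def TrivialOn (W : Set X) : Prop :=
  ∀ ⦃x : X⦄ (u : Path x x), range u ⊆ W → v.val (Path.Homotopic.Quotient.mk u) = 1

variable {v}

theorem TrivialOn.mono {W W' : Set X} (h : v.TrivialOn W') (hW : W ⊆ W') : v.TrivialOn W :=
  fun _ u hu => h u (hu.trans hW)

/-- A cocycle that vanishes on loops is a coboundary. -/
theorem TrivialOn.exists_potential {W : Set X} (h : v.TrivialOn W) :
    ∃ f : X → K, ∀ {x y : X} (u : Path x y), range u ⊆ W →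
      f y = v.val (Path.Homotopic.Quotient.mk u) * f x := by
  classical
  let s : Setoid X :=
    { r := fun x y => x = y ∨ JoinedIn W x y
      iseqv := by
        refine ⟨fun x => Or.inl rfl, ?_, ?_⟩
        · rintro x y (rfl | h)
          · exact Or.inl rfl
          · exact Or.inr h.symm
        · rintro x y z (rfl | h) (rfl | h')
          · exact Or.inl rfl
          · exact Or.inr h'
          · exact Or.inr h
          · exact Or.inr (h.trans h') }
  let r : X → X := fun x => (Quotient.mk s x).out
  have hr : ∀ x ∈ W, JoinedIn W (r x) x := by
    intro x hx
    rcases Quotient.exact (Quotient.out_eq (Quotient.mk s x)) with h' | h'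
    · change JoinedIn W (Quotient.mk s x).out x
      rw [h']
      exact JoinedIn.refl hx
    · exact h'
  -- The potential is the value of the cocycle along a path in `W` from the chosen representative of
  -- the path component; the value `1` off `W` is arbitrary.
  refine ⟨fun x => if hx : x ∈ W then v.val (Path.Homotopic.Quotient.mk (hr x hx).somePath) else 1,
    fun {x y} u hu => ?_⟩
  have hx : x ∈ W := hu ⟨0, u.source⟩
  have hy : y ∈ W := hu ⟨1, u.target⟩
  have hxy : r x = r y := by
    have : Quotient.mk s x = Quotient.mk s y :=
      Quotient.sound (Or.inr ⟨u, fun t => hu ⟨t, rfl⟩⟩)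
    change (Quotient.mk s x).out = (Quotient.mk s y).out
    rw [this]
  simp only [dif_pos hx, dif_pos hy]
  have key : ∀ {a b : X} (p : Path a x) (q : Path b y), a = b → range p ⊆ W → range q ⊆ W →
      v.val (Path.Homotopic.Quotient.mk q) =
        v.val (Path.Homotopic.Quotient.mk u) * v.val (Path.Homotopic.Quotient.mk p) := by
    rintro a _ p q rfl hp hq
    have := h ((p.trans u).trans q.symm) (by
      rw [Path.trans_range, Path.trans_range, Path.symm_range]
      exact union_subset (union_subset hp hu) hq)
    rw [Path.Homotopic.Quotient.mk_trans, v.val_trans, Path.Homotopic.Quotient.mk_symm, v.val_symm,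
      Path.Homotopic.Quotient.mk_trans, v.val_trans, inv_mul_eq_one] at this
    exact this
  refine key _ _ hxy ?_ ?_
  · rintro _ ⟨t, rfl⟩
    exact (hr x hx).somePath_mem t
  · rintro _ ⟨t, rfl⟩
    exact (hr y hy).somePath_mem t

/-- The gluing step of the van Kampen theorem. -/
theorem TrivialOn.union {A B : Set X} (hA : v.TrivialOn A) (hB : v.TrivialOn B) (hAo : IsOpen A)
    (hBo : IsOpen B) (hAB : IsPathConnected (A ∩ B)) : v.TrivialOn (A ∪ B) := by
  classical
  obtain ⟨f, hf⟩ := hA.exists_potential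
  obtain ⟨g, hg⟩ := hB.exists_potential
  obtain ⟨x₀, hx₀, hjoin⟩ := hAB
  -- The potential on `B` is renormalized to agree with `f` at `x₀`, hence on all of the
  -- path-connected overlap. The two glue to one potential on `A ∪ B`, and a cocycle with a
  -- potential vanishes on loops.
  let F : X → K := fun x => if x ∈ A then f x else g x * (g x₀)⁻¹ * f x₀
  have hFA : ∀ x ∈ A, F x = f x := fun x hx => if_pos hx
  have hFB : ∀ x ∈ B, F x = g x * (g x₀)⁻¹ * f x₀ := by
    intro x hx
    by_cases hxA : x ∈ A
    · have hj := hjoin ⟨hxA, hx⟩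
      have hr : range hj.somePath ⊆ A ∩ B := by
        rintro _ ⟨t, rfl⟩
        exact hj.somePath_mem t
      rw [hFA x hxA, hf hj.somePath (hr.trans inter_subset_left),
        hg hj.somePath (hr.trans inter_subset_right), mul_inv_cancel_right]
    · exact if_neg hxA
  intro x u hu
  have key := Path.Homotopic.Quotient.induction_of_open_cover (V := fun b : Bool => cond b A B)
    (fun b => by cases b <;> assumption)
    (Q := fun x y q => F y = v.val q * F x) (fun p q hp hq => by
      rw [hq, hp, v.val_trans, mul_assoc]) u (fun t => by
        rcases hu ⟨t, rfl⟩ with h | h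
        · exact ⟨true, h⟩
        · exact ⟨false, h⟩) (fun {a b} w i hw _ => by
        have ha : a ∈ range w := ⟨0, w.source⟩
        have hb : b ∈ range w := ⟨1, w.target⟩
        cases i
        · rw [hFB _ (hw ha), hFB _ (hw hb), hg w hw]
          simp only [mul_assoc]
        · rw [hFA _ (hw ha), hFA _ (hw hb), hf w hw])
  exact right_eq_mul.1 key

end PathCocycle

end PathClasses

/-! ### Degrees of loops in the circle -/

section CircleDegree

open unitInterval

/-- The degree of loops in the circle, measured as the increment of a lift of the angle. -/
theorem exists_circle_degree (w : Circle) :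
    ∃ (e : ℝ) (d : FundamentalGroup Circle w → ℝ), Circle.exp e = w ∧ Function.Injective d ∧
      (∀ g (k : ℕ), d (g ^ k) = k * d g) ∧
      (∀ u : Path w w, ∃ θ : C(I, ℝ), θ 0 = e ∧ ∀ t, Circle.exp (θ t) = u t) ∧
      ∀ (u : Path w w) (θ : C(I, ℝ)), θ 0 = e → (∀ t, Circle.exp (θ t) = u t) →
        d (FundamentalGroup.fromPath (Path.Homotopic.Quotient.mk u)) = θ 1 - e := by
  have hq := Circle.isAddQuotientCoveringMap_exp
  have cov := Circle.isCoveringMap_exp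
  obtain ⟨e, he⟩ := Circle.exp_surjective w
  let E : Circle.exp ⁻¹' {w} := ⟨e, he⟩
  let D := hq.fundamentalGroupToMulOpposite E
  refine ⟨e, fun g => ((D g).unop.toAdd : ℝ), he, ?_, ?_, ?_, ?_⟩
  · intro g h hgh
    apply hq.fundamentalGroupToMulOpposite_injective E
    apply MulOpposite.unop_injective
    apply Multiplicative.toAdd.injective
    exact Subtype.ext hgh
  · intro g k
    simp [map_pow]
  · intro u
    have hu : u.toContinuousMap 0 = Circle.exp e := by
      rw [he]
      exact u.source
    exact ⟨cov.liftPath u.toContinuousMap e hu, cov.liftPath_zero .., fun t =>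
      congrFun (cov.liftPath_lifts u.toContinuousMap e hu) t⟩
  · intro u θ h0 hθ
    have h₁ : Circle.exp (θ 1) = w := by rw [hθ, u.target]
    have key := hq.unop_fundamentalGroupToMulOpposite_smul (e := E)
      (γ := FundamentalGroup.fromPath (Path.Homotopic.Quotient.mk u))
    have hmono : hq.isCoveringMap.monodromy (Path.Homotopic.Quotient.mk u) E = ⟨θ 1, h₁⟩ := by
      let Θ : Path e (θ 1) := ⟨θ, h0, rfl⟩
      refine hq.isCoveringMap.monodromy_eq_of_map_eq (ey := ⟨θ 1, h₁⟩)
        (Path.Homotopic.Quotient.mk Θ) ?_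
      refine congrArg Path.Homotopic.Quotient.mk ?_
      exact Path.ext (funext hθ)
    have h₂ : (((D (FundamentalGroup.fromPath (Path.Homotopic.Quotient.mk u))).unop.toAdd : ℝ) + e)
        = θ 1 := key.trans (congrArg Subtype.val hmono)
    simp only
    linarith

theorem circle_exp_eq_one {r : ℝ} : Circle.exp r = 1 ↔ ∃ m : ℤ, r = m * (2 * Real.pi) := by
  rw [← Circle.exp_zero, Circle.exp_eq_exp]
  simp

end CircleDegree

/-! ### Loops and fibres in a fibred solid torus -/

section SolidTorus

open unitInterval

instance : ContractibleSpace openDisc :=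
  (convex_ball (0 : ℂ) 1).contractibleSpace ⟨0, by simp⟩

/-- The disc factor is contractible, so a loop class is determined by its circle component. -/
theorem torus_class_ext {x : openDisc × Circle} {g h : FundamentalGroup (openDisc × Circle) x}
    (hgh : FundamentalGroup.map ⟨Prod.snd, continuous_snd⟩ x g =
      FundamentalGroup.map ⟨Prod.snd, continuous_snd⟩ x h) : g = h := by
  obtain ⟨z, w⟩ := x
  rw [← Path.Homotopic.prod_projLeft_projRight g, ← Path.Homotopic.prod_projLeft_projRight h]
  congr 1
  exact Subsingleton.elim _ _

theorem exists_torus_generator (x : openDisc × Circle) :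
    ∃ κ : FundamentalGroup (openDisc × Circle) x, ∀ g, g ∈ Subgroup.zpowers κ := by
  have hq := Circle.isAddQuotientCoveringMap_exp
  obtain ⟨e, he⟩ := Circle.exp_surjective x.2
  let E : Circle.exp ⁻¹' {x.2} := ⟨e, he⟩
  let φ := (hq.fundamentalGroupToMulOpposite E).comp
    (FundamentalGroup.map ⟨Prod.snd, continuous_snd⟩ x)
  have hφ : Function.Injective φ :=
    (hq.fundamentalGroupToMulOpposite_injective E).comp fun _ _ => torus_class_ext
  have : IsCyclic (Multiplicative (AddSubgroup.zmultiples (2 * Real.pi)))ᵐᵒᵖ :=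
    isCyclic_of_surjective (MulOpposite.opMulEquiv (M := Multiplicative (AddSubgroup.zmultiples (2 * Real.pi))))
      (MulEquiv.surjective _)
  have := isCyclic_of_injective φ hφ
  exact IsCyclic.exists_generator

variable {a : ℕ} {ν : ℤ}

/-- The `a`-th power of a loop in the fibred solid torus is homotopic into a fibre. -/
theorem exists_fibre_loop_eq_pow {x : openDisc × Circle}
    (g : FundamentalGroup (openDisc × Circle) x) :
    ∃ f : Path x x, (∀ t, fibredTorusProj a ν (f t) = fibredTorusProj a ν x) ∧
      FundamentalGroup.fromPath (Path.Homotopic.Quotient.mk f) = g ^ a := by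
  obtain ⟨u, rfl⟩ := Path.Homotopic.Quotient.mk_surjective g
  obtain ⟨z, w⟩ := x
  obtain ⟨e, d, he, hinj, hpow, hlift, hd⟩ := exists_circle_degree w
  obtain ⟨θ, h0, hθ⟩ := hlift (u.map continuous_snd)
  have h1 : Circle.exp (θ 1 - e) = 1 := by
    rw [Circle.exp_sub, he, hθ, Path.target, div_self']
  let c : I → Circle := fun t => Circle.exp (θ t - e)
  have hc : Continuous c := by fun_prop
  have hc0 : c 0 = 1 := by simp [c, h0]
  have hc1 : c 1 = 1 := h1
  have hmem : ∀ t, ((c t ^ (-ν) : Circle) : ℂ) * (z : ℂ) ∈ openDisc := by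
    intro t
    have := z.2
    rw [mem_ball_zero_iff] at this ⊢
    rwa [norm_mul, Circle.norm_coe, one_mul]
  -- The loop moves along the orbit of the fibre action, driven by `c`, the circle component of `u`
  -- divided by its initial value. Its own circle component then winds `a` times as much as that of
  -- `u`.
  let f : Path ((z, w) : openDisc × Circle) (z, w) :=
    { toFun := fun t => (⟨((c t ^ (-ν) : Circle) : ℂ) * z, hmem t⟩, w * c t ^ a)
      continuous_toFun := by
        have hcν : Continuous fun t => c t ^ (-ν) := hc.zpow _
        exact (((continuous_subtype_val.comp hcν).mul continuous_const).subtype_mk _).prodMk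
          (by fun_prop)
      source' := by simp [hc0]
      target' := by simp [hc1] }
  refine ⟨f, fun t => ?_, torus_class_ext ?_⟩
  · have hcz : ((c t : Circle) : ℂ) ≠ 0 := Circle.coe_ne_zero _
    change (((c t ^ (-ν) : Circle) : ℂ) * z) ^ a * (((w * c t ^ a) ^ ν : Circle) : ℂ) = _
    simp only [fibredTorusProj, Circle.coe_zpow, Circle.coe_mul, Circle.coe_pow, mul_pow,
      mul_zpow]
    have : (((c t : Circle) : ℂ) ^ (-ν)) ^ a * (((c t : Circle) : ℂ) ^ a) ^ ν = 1 := by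
      rw [← zpow_natCast, ← zpow_natCast, ← zpow_mul, ← zpow_mul, ← zpow_add₀ hcz]
      rw [show -ν * (a : ℤ) + a * ν = 0 by ring, zpow_zero]
    linear_combination (z : ℂ) ^ a * (w : ℂ) ^ ν * this
  · apply hinj
    let θ' : C(I, ℝ) := ⟨fun t => e + a * (θ t - e), by fun_prop⟩
    rw [map_pow, hpow]
    erw [hd (f.map continuous_snd) θ' (by simp [θ', h0]) (fun t => by
        change Circle.exp (e + a * (θ t - e)) = w * c t ^ a
        rw [Circle.exp_add, he, ← nsmul_eq_mul, Circle.exp_nsmul]), 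
      hd (u.map continuous_snd) θ h0 hθ]
    simp [θ']

/-- A loop in a fibre that winds around the core, or is regular, is an `a`-th power. -/
theorem exists_eq_pow_of_fibre_loop (ha : a ≠ 0) (hν : IsCoprime (a : ℤ) ν)
    {x : openDisc × Circle} (hx : (x.1 : ℂ) ≠ 0 ∨ a = 1) (f : Path x x)
    (hf : ∀ t, fibredTorusProj a ν (f t) = fibredTorusProj a ν x) :
    ∃ g : FundamentalGroup (openDisc × Circle) x,
      g ^ a = FundamentalGroup.fromPath (Path.Homotopic.Quotient.mk f) := by
  rcases hx with hx | rfl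
  swap
  · exact ⟨_, pow_one _⟩
  obtain ⟨z, w⟩ := x
  simp only at hx
  obtain ⟨e, d, he, hinj, hpow, hlift, hd⟩ := exists_circle_degree w
  obtain ⟨θ, h0, hθ⟩ := hlift (f.map continuous_snd)
  have hθw : ∀ t, Circle.exp (θ t - e) = (f t).2 / w := by
    intro t
    rw [Circle.exp_sub, he, hθ]
    rfl
  have hw0 : ∀ c : Circle, (c : ℂ) ≠ 0 := fun c => Circle.coe_ne_zero _
  have hfz : ∀ t, (((f t).1 : ℂ) / z) ^ a * ((((f t).2 / w) ^ ν : Circle) : ℂ) = 1 := by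
    intro t
    have := hf t
    simp only [fibredTorusProj] at this
    rw [div_pow, div_zpow, Circle.coe_div, div_mul_div_comm, this, div_self]
    exact mul_ne_zero (pow_ne_zero _ hx) (hw0 _)
  have hnorm : ∀ t, ‖((f t).1 : ℂ) / z‖ = 1 := by
    intro t
    have := congrArg norm (hfz t)
    rw [norm_mul, Circle.norm_coe, mul_one, norm_pow, norm_one] at this
    exact (pow_eq_one_iff_of_nonneg (norm_nonneg _) ha).1 this
  let ζ : Path (1 : Circle) 1 :=
    { toFun := fun t => ⟨((f t).1 : ℂ) / z, mem_sphere_zero_iff_norm.2 (hnorm t)⟩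
      continuous_toFun := by
        refine Continuous.subtype_mk ?_ _
        exact (continuous_subtype_val.comp (continuous_fst.comp f.continuous)).div_const _
      source' := by
        ext
        simp [hx]
      target' := by
        ext
        simp [hx] }
  obtain ⟨e', -, he', -, -, hlift', -⟩ := exists_circle_degree 1
  obtain ⟨η, hη0, hη⟩ := hlift' ζ
  -- In a fibre, `(z'/z) ^ a * (w'/w) ^ ν = 1`. The left side below lifts this constant loop and
  -- starts at `0`, so it vanishes.
  have hzero : (fun t : I => a * (η t - e') + ν * (θ t - e)) = fun _ => 0 := by
    refine Circle.isCoveringMap_exp.eq_of_comp_eq (by fun_prop) continuous_const ?_ 0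
      (by simp [h0, hη0])
    funext t
    rw [Function.comp_apply, Function.comp_apply, Circle.exp_zero, Circle.exp_add,
      ← nsmul_eq_mul, Circle.exp_nsmul, ← zsmul_eq_mul, Circle.exp_zsmul, Circle.exp_sub, he', div_one, hη, hθw]
    ext
    rw [Circle.coe_mul, Circle.coe_pow, Circle.coe_one]
    exact hfz t
  obtain ⟨k, hk⟩ := circle_exp_eq_one.1 (show Circle.exp (η 1 - e') = 1 by
    rw [Circle.exp_sub, hη, he', ζ.target, div_one])
  obtain ⟨m, hm⟩ := circle_exp_eq_one.1 (show Circle.exp (θ 1 - e) = 1 by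
    rw [hθw, f.target, div_self'])
  have hkm : (a : ℤ) * k + ν * m = 0 := by
    have h₁ := congrFun hzero 1
    simp only [hk, hm] at h₁
    have h₂ : ((a : ℝ) * k + ν * m) * (2 * Real.pi) = 0 := by linarith
    have h₃ := (mul_eq_zero.1 h₂).resolve_right (by positivity)
    exact_mod_cast h₃
  -- The windings `k` and `m` of the two coordinates satisfy `a k + ν m = 0`, and `a` is prime to
  -- `ν`. A loop winding `m / a` times around the circle factor is the required root.
  obtain ⟨l, rfl⟩ : (a : ℤ) ∣ m := hν.dvd_of_dvd_mul_left ⟨-k, by linarith⟩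
  let u : Path ((z, w) : openDisc × Circle) (z, w) :=
    { toFun := fun t => (z, Circle.exp (e + l * (2 * Real.pi) * t))
      continuous_toFun := by fun_prop
      source' := by simp [he]
      target' := by
        have : Circle.exp (l * (2 * Real.pi)) = 1 := circle_exp_eq_one.2 ⟨l, rfl⟩
        simp [Circle.exp_add, he, this] }
  refine ⟨FundamentalGroup.fromPath (Path.Homotopic.Quotient.mk u), torus_class_ext (hinj ?_)⟩
  let θ' : C(I, ℝ) := ⟨fun t => e + l * (2 * Real.pi) * t, by fun_prop⟩
  rw [map_pow, hpow]
  erw [hd (f.map continuous_snd) θ h0 hθ, hd (u.map continuous_snd) θ' (by simp [θ']) (fun t => rfl)]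
  rw [hm]
  simp [θ']
  ring

end SolidTorus

/-! ### Small fibred solid tori in `M` -/

section TorusChart

variable {M B : Type*} [TopologicalSpace M] [TopologicalSpace B]

/-- A parametrization of the preimage of `U` by a fibred solid torus with core over `b`. -/
structure IsTorusChart (p : M → B) (b : B) (a : ℕ) (U : Set B) : Prop where
  isOpen : IsOpen U
  mem : b ∈ U
  ne_zero : a ≠ 0
  exists_param : ∃ (ν : ℤ) (Ψ : openDisc × Circle → M), IsCoprime (a : ℤ) ν ∧ IsEmbedding Ψ ∧
    range Ψ = p ⁻¹' U ∧
    (∀ s t, p (Ψ s) = p (Ψ t) ↔ fibredTorusProj a ν s = fibredTorusProj a ν t) ∧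
    ∀ s, p (Ψ s) = b ↔ (s.1 : ℂ) = 0

theorem norm_fibredTorusProj (a : ℕ) (ν : ℤ) (x : openDisc × Circle) :
    ‖fibredTorusProj a ν x‖ = ‖(x.1 : ℂ)‖ ^ a := by
  rw [fibredTorusProj, norm_mul, Circle.norm_coe, mul_one, norm_pow]

/-- Shrinking the disc by the factor `s`. -/
def shrinkDisc {s : ℝ} (hs : 0 < s) (hs1 : s ≤ 1) (x : openDisc × Circle) : openDisc × Circle :=
  (⟨s * x.1, by
    have := x.1.2
    rw [mem_ball_zero_iff] at this ⊢
    rw [norm_mul, Complex.norm_real, Real.norm_of_nonneg hs.le]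
    nlinarith [norm_nonneg (x.1 : ℂ)]⟩, x.2)

theorem isEmbedding_shrinkDisc {s : ℝ} (hs : 0 < s) (hs1 : s ≤ 1) :
    IsEmbedding (shrinkDisc hs hs1) := by
  have h₁ : IsEmbedding fun z : ℂ => (s : ℂ) * z :=
    (Homeomorph.mulLeft₀ (s : ℂ) (by exact_mod_cast hs.ne')).isEmbedding
  have h₂ : IsEmbedding fun z : openDisc => (shrinkDisc hs hs1 (z, 1)).1 := by
    refine IsEmbedding.of_comp ?_ continuous_subtype_val
      (h₁.comp (IsEmbedding.subtypeVal (p := fun z => z ∈ openDisc)))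
    refine Continuous.subtype_mk ?_ _
    fun_prop
  exact h₂.prodMap IsEmbedding.id

theorem fibredTorusProj_shrinkDisc {s : ℝ} (hs : 0 < s) (hs1 : s ≤ 1) (a : ℕ) (ν : ℤ)
    (x : openDisc × Circle) :
    fibredTorusProj a ν (shrinkDisc hs hs1 x) = (s : ℂ) ^ a * fibredTorusProj a ν x := by
  simp only [fibredTorusProj, shrinkDisc, mul_pow, mul_assoc]

/-- Shrinking the disc of the solid torus by `s` scales the base coordinate by `s ^ a`, and the
smaller piece is again a fibred solid torus of the same type. -/
theorem HasFibredTorusNhd.exists_isTorusChart {p : M → B} {b : B} {a : ℕ}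
    (h : HasFibredTorusNhd p b a) (ha : a ≠ 0) {W : Set B} (hW : W ∈ 𝓝 b) :
    ∃ U ⊆ W, IsTorusChart p b a U := by
  obtain ⟨ν, U, hb, φ, Φ, hν, hU, hφb, hΦ⟩ := h
  obtain ⟨r, hr, hrW⟩ : ∃ r > 0, ∀ y : openDisc, ‖(y : ℂ)‖ < r → (φ.symm y : B) ∈ W := by
    have hc : ContinuousAt (fun y : openDisc => (φ.symm y : B)) (φ ⟨b, hb⟩) := by fun_prop
    have hm := hc.preimage_mem_nhds (t := W) (by simpa using hW)
    obtain ⟨r, hr, hrW⟩ := Metric.mem_nhds_iff.1 hm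
    refine ⟨r, hr, fun y hy => hrW ?_⟩
    rw [Metric.mem_ball, Subtype.dist_eq, hφb, dist_zero_right]
    exact hy
  -- As `s ≤ 1` and `a ≠ 0`, also `s ^ a ≤ r`, so the shrunken base disc stays in `W`.
  set s := min r 1
  have hs : 0 < s := lt_min hr one_pos
  have hs1 : s ≤ 1 := min_le_right _ _
  have hsa : s ^ a ≤ r := (pow_le_of_le_one hs.le hs1 ha).trans (min_le_left _ _)
  have hval : ∀ x : openDisc × Circle, (φ ⟨p (Φ.symm x : M), (Φ.symm x).2⟩ : ℂ) =
      fibredTorusProj a ν x := by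
    intro x
    rw [hΦ, Φ.apply_symm_apply]
  let V : Set U := {y | ‖(φ y : ℂ)‖ < s ^ a}
  have hV : IsOpen V := isOpen_lt (by fun_prop) continuous_const
  refine ⟨Subtype.val '' V, ?_, hU.isOpenMap_subtype_val _ hV, ⟨⟨b, hb⟩, ?_, rfl⟩, ha, ν,
    fun x => (Φ.symm (shrinkDisc hs hs1 x) : M), hν, ?_, ?_, ?_, ?_⟩
  · rintro _ ⟨y, hy, rfl⟩
    simpa using hrW (φ y) (lt_of_lt_of_le hy hsa)
  · change ‖(φ ⟨b, hb⟩ : ℂ)‖ < s ^ a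
    rw [hφb, norm_zero]
    positivity
  · exact IsEmbedding.subtypeVal.comp (Φ.symm.isEmbedding.comp (isEmbedding_shrinkDisc hs hs1))
  · ext m
    constructor
    · rintro ⟨x, rfl⟩
      refine ⟨⟨_, (Φ.symm (shrinkDisc hs hs1 x)).2⟩, ?_, rfl⟩
      change ‖(φ _ : ℂ)‖ < _
      rw [hval, norm_fibredTorusProj]
      refine pow_lt_pow_left₀ ?_ (norm_nonneg _) ha
      have := x.1.2
      rw [mem_ball_zero_iff] at this
      simp only [shrinkDisc, norm_mul, Complex.norm_real, Real.norm_of_nonneg hs.le]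
      nlinarith
    · rintro ⟨y, hy, hym⟩
      have hm : p m ∈ U := hym ▸ y.2
      obtain rfl : y = ⟨p m, hm⟩ := Subtype.ext hym
      change ‖(φ _ : ℂ)‖ < _ at hy
      rw [hΦ ⟨m, hm⟩, norm_fibredTorusProj] at hy
      have hz := lt_of_pow_lt_pow_left₀ a hs.le hy
      refine ⟨(⟨((Φ ⟨m, hm⟩).1 : ℂ) / s, ?_⟩, (Φ ⟨m, hm⟩).2), ?_⟩
      · rw [mem_ball_zero_iff, norm_div, Complex.norm_real, Real.norm_of_nonneg hs.le, div_lt_one hs]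
        exact hz
      · have : shrinkDisc hs hs1 (⟨((Φ ⟨m, hm⟩).1 : ℂ) / s, by
            rw [mem_ball_zero_iff, norm_div, Complex.norm_real, Real.norm_of_nonneg hs.le,
              div_lt_one hs]
            exact hz⟩, (Φ ⟨m, hm⟩).2) = Φ ⟨m, hm⟩ := by
          refine Prod.ext (Subtype.ext ?_) rfl
          exact mul_div_cancel₀ _ (by exact_mod_cast hs.ne')
        simp only [this, Homeomorph.symm_apply_apply]
  · intro x y
    have hs0 : (s : ℂ) ^ a ≠ 0 := pow_ne_zero _ (by exact_mod_cast hs.ne')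
    rw [← mul_right_inj' hs0, ← fibredTorusProj_shrinkDisc hs hs1,
      ← fibredTorusProj_shrinkDisc hs hs1, ← hval, ← hval, ← Subtype.ext_iff, φ.injective.eq_iff,
      Subtype.mk.injEq]
  · intro x
    have h₁ : p (Φ.symm (shrinkDisc hs hs1 x) : M) = b ↔
        (φ ⟨p (Φ.symm (shrinkDisc hs hs1 x) : M), (Φ.symm (shrinkDisc hs hs1 x)).2⟩ : ℂ) = 0 := by
      rw [← hφb, ← Subtype.ext_iff, φ.injective.eq_iff, Subtype.mk.injEq]
    rw [h₁, hval, ← norm_eq_zero, norm_fibredTorusProj, pow_eq_zero_iff ha, norm_eq_zero]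
    simp [shrinkDisc, hs.ne']

instance : PathConnectedSpace Circle :=
  Circle.exp_surjective.pathConnectedSpace Circle.exp.continuous

theorem Topology.IsEmbedding.exists_path_map_eq {X Y : Type*} [TopologicalSpace X]
    [TopologicalSpace Y] {Ψ : X → Y} (hΨ : IsEmbedding Ψ) {s t : X} (u : Path (Ψ s) (Ψ t))
    (hu : range u ⊆ range Ψ) : ∃ v : Path s t, v.map hΨ.continuous = u := by
  choose f hf using fun τ => hu (mem_range_self τ)
  refine ⟨⟨⟨f, hΨ.continuous_iff.2 ?_⟩, hΨ.injective ?_, hΨ.injective ?_⟩, ?_⟩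
  · rw [show Ψ ∘ f = u from funext hf]
    exact u.continuous
  · simpa using hf 0
  · simpa using hf 1
  · exact Path.ext (funext hf)

/-- The `a`-th powers of the classes of loops in `V`. -/
def loopPowers (V : Set M) (a : ℕ) (x : M) : Set (FundamentalGroup M x) :=
  {g | ∃ u : Path x x, range u ⊆ V ∧
    g = (FundamentalGroup.fromPath (Path.Homotopic.Quotient.mk u)) ^ a}

theorem pathConj_mem_loopPowers {V : Set M} {a : ℕ} {x y : M} (q : Path x y) (hq : range q ⊆ V)
    {g : FundamentalGroup M y} (hg : g ∈ loopPowers V a y) :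
    pathConj (Path.Homotopic.Quotient.mk q) g ∈ loopPowers V a x := by
  obtain ⟨u, hu, rfl⟩ := hg
  refine ⟨q.trans (u.trans q.symm), ?_, ?_⟩
  · rw [Path.trans_range, Path.trans_range, Path.symm_range]
    exact union_subset hq (union_subset hu hq)
  · rw [map_pow]
    rfl

namespace IsTorusChart

variable {p : M → B} {b : B} {a : ℕ} {U : Set B} (h : IsTorusChart p b a U)
include h

theorem isPathConnected : IsPathConnected (p ⁻¹' U) := by
  obtain ⟨ν, Ψ, -, hΨ, hr, -⟩ := h.exists_param
  rw [← hr]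
  exact isPathConnected_range hΨ.continuous

theorem exists_loopPowers_eq_zpowers {x : M} (hx : p x ∈ U) :
    ∃ κ : FundamentalGroup M x, loopPowers (p ⁻¹' U) a x = Subgroup.zpowers κ := by
  obtain ⟨ν, Ψ, -, hΨ, hr, -⟩ := h.exists_param
  obtain ⟨s, rfl⟩ : x ∈ range Ψ := hr ▸ hx
  obtain ⟨κ, hκ⟩ := exists_torus_generator s
  let F : FundamentalGroup (openDisc × Circle) s →* FundamentalGroup M (Ψ s) :=
    FundamentalGroup.map ⟨Ψ, hΨ.continuous⟩ s
  refine ⟨F κ ^ a, ?_⟩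
  ext g
  constructor
  · rintro ⟨u, hu, rfl⟩
    obtain ⟨v, rfl⟩ := hΨ.exists_path_map_eq u (hr ▸ hu)
    obtain ⟨n, hn⟩ := hκ (FundamentalGroup.fromPath (Path.Homotopic.Quotient.mk v))
    have : FundamentalGroup.fromPath (Path.Homotopic.Quotient.mk (v.map hΨ.continuous)) =
        F κ ^ n := by
      rw [← map_zpow]
      exact (congrArg F hn).symm
    exact ⟨n, by rw [this, ← zpow_natCast, ← zpow_natCast, zpow_comm]⟩
  · rintro ⟨n, rfl⟩
    obtain ⟨u, hu⟩ := Path.Homotopic.Quotient.mk_surjective (κ ^ n)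
    refine ⟨u.map hΨ.continuous, ?_, ?_⟩
    · rw [← hr]
      rintro _ ⟨t, rfl⟩
      exact mem_range_self _
    · have : FundamentalGroup.fromPath (Path.Homotopic.Quotient.mk (u.map hΨ.continuous)) =
          F κ ^ n := by
        rw [← map_zpow]
        exact congrArg F hu
      simp only [this, ← zpow_natCast]
      rw [zpow_comm]

/-- Away from singular cores, the subgroup of `a`-th powers consists of the loops in the fibre. -/
theorem loopPowers_eq_fibre {x : M} (hx : p x ∈ U) (hreg : p x ≠ b ∨ a = 1) :
    loopPowers (p ⁻¹' U) a x = {g | ∃ f : Path x x, (∀ t, p (f t) = p x) ∧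
      g = FundamentalGroup.fromPath (Path.Homotopic.Quotient.mk f)} := by
  obtain ⟨ν, Ψ, hν, hΨ, hr, hfib, hcore⟩ := h.exists_param
  obtain ⟨s, rfl⟩ : x ∈ range Ψ := hr ▸ hx
  let F : FundamentalGroup (openDisc × Circle) s →* FundamentalGroup M (Ψ s) :=
    FundamentalGroup.map ⟨Ψ, hΨ.continuous⟩ s
  ext g
  constructor
  · rintro ⟨u, hu, rfl⟩
    obtain ⟨v, rfl⟩ := hΨ.exists_path_map_eq u (hr ▸ hu)
    obtain ⟨f, hf, hfv⟩ := exists_fibre_loop_eq_pow (a := a) (ν := ν)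
      (FundamentalGroup.fromPath (Path.Homotopic.Quotient.mk v))
    refine ⟨f.map hΨ.continuous, fun t => (hfib _ _).2 (hf t), ?_⟩
    have := congrArg F hfv
    rw [map_pow] at this
    exact this.symm
  · rintro ⟨f, hf, rfl⟩
    have hfU : range f ⊆ range Ψ := by
      rw [hr]
      rintro _ ⟨t, rfl⟩
      rw [mem_preimage, hf]
      exact hx
    obtain ⟨v, rfl⟩ := hΨ.exists_path_map_eq f hfU
    obtain ⟨g, hg⟩ := exists_eq_pow_of_fibre_loop h.ne_zero hν
      (hreg.imp_left fun h' => fun h0 => h' ((hcore s).2 h0)) v (fun t => (hfib _ _).1 (hf t))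
    obtain ⟨u, rfl⟩ := Path.Homotopic.Quotient.mk_surjective g
    refine ⟨u.map hΨ.continuous, ?_, ?_⟩
    · rw [← hr]
      rintro _ ⟨t, rfl⟩
      exact mem_range_self _
    · have := congrArg F hg
      rw [map_pow] at this
      exact this.symm

end IsTorusChart

end TorusChart

/-! ### Local-to-global induction for intervals and rectangles -/

section Rectangles

/-- A property of open intervals that holds locally, passes to subintervals, and is stable under
unions of overlapping intervals holds for all intervals. -/
theorem interval_induction {Q : ℝ → ℝ → Prop}
    (mono : ∀ {a b a' b'}, a ≤ a' → b' ≤ b → Q a b → Q a' b')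
    (glue : ∀ {a b c d}, a ≤ c → c < b → b ≤ d → Q a b → Q c d → Q a d)
    (loc : ∀ x, ∃ ε > 0, Q (x - ε) (x + ε)) (a b : ℝ) : Q a b := by
  -- This set is clopen and contains `a`. The slack `ε` makes it open; gluing a local interval onto
  -- one that reaches into it makes it closed.
  let S : Set ℝ := {t | ∃ ε > 0, Q a (t + ε)}
  have hopen : IsOpen S := by
    rw [Metric.isOpen_iff]
    rintro t ⟨ε, hε, ht⟩
    refine ⟨ε / 2, by positivity, fun t' ht' => ⟨ε / 2, by positivity, mono le_rfl ?_ ht⟩⟩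
    rw [Metric.mem_ball, Real.dist_eq, abs_lt] at ht'
    linarith
  have hclosed : IsClosed S := by
    rw [← isOpen_compl_iff, Metric.isOpen_iff]
    intro t ht
    obtain ⟨ε, hε, hQ⟩ := loc t
    refine ⟨ε, hε, fun t' ht' hS => ht ?_⟩
    obtain ⟨ε', hε', hQ'⟩ := hS
    rw [Metric.mem_ball, Real.dist_eq, abs_lt] at ht'
    by_cases h₁ : t < t' + ε'
    · exact ⟨t' + ε' - t, by linarith, mono le_rfl (by linarith) hQ'⟩
    · refine ⟨ε, hε, ?_⟩
      by_cases h₂ : a ≤ t - ε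
      · exact glue h₂ (by linarith) (by linarith) hQ' hQ
      · exact mono (by linarith) le_rfl hQ
  have hne : a ∈ S := by
    obtain ⟨ε, hε, hQ⟩ := loc a
    exact ⟨ε, hε, mono (by linarith) le_rfl hQ⟩
  have huniv : S = univ := IsClopen.eq_univ ⟨hclosed, hopen⟩ ⟨a, hne⟩
  obtain ⟨ε, hε, hQ⟩ : b ∈ S := huniv ▸ mem_univ b
  exact mono le_rfl (by linarith) hQ

/-- A property of open subsets of the plane that holds locally, passes to subsets, and is stable
under unions of sets with connected intersection holds for all open rectangles. -/
theorem rectangle_induction {P : Set (ℝ × ℝ) → Prop}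
    (mono : ∀ {V W : Set (ℝ × ℝ)}, V ⊆ W → P W → P V)
    (glue : ∀ {V W : Set (ℝ × ℝ)}, IsOpen V → IsOpen W → IsConnected (V ∩ W) → P V → P W →
      P (V ∪ W))
    (loc : ∀ x, ∃ W ∈ 𝓝 x, P W) (a b c d : ℝ) : P (Ioo a b ×ˢ Ioo c d) := by
  have conn : ∀ {a b c d : ℝ}, a < b → c < d → IsConnected (Ioo a b ×ˢ Ioo c d) :=
    fun h₁ h₂ => (isConnected_Ioo h₁).prod (isConnected_Ioo h₂)
  have op : ∀ {a b c d : ℝ}, IsOpen (Ioo a b ×ˢ Ioo c d) := isOpen_Ioo.prod isOpen_Ioo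
  have empty : P ∅ := by
    obtain ⟨W, -, hW⟩ := loc (0, 0)
    exact mono (empty_subset W) hW
  have union : ∀ {a b c d : ℝ}, a ≤ c → c < b → b ≤ d → Ioo a b ∪ Ioo c d = Ioo a d := by
    intro a b c d h₁ h₂ h₃
    ext t
    simp only [mem_union, mem_Ioo]
    constructor
    · rintro (h | h) <;> constructor <;> linarith
    · rintro ⟨h, h'⟩
      rcases lt_or_ge t b with hb | hb
      · exact Or.inl ⟨h, hb⟩
      · exact Or.inr ⟨by linarith, h'⟩
  have inter : ∀ {a b c d : ℝ}, a ≤ c → b ≤ d → Ioo a b ∩ Ioo c d = Ioo c b := by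
    intro a b c d h₁ h₂
    rw [Ioo_inter_Ioo, sup_eq_right.2 h₁, inf_eq_left.2 h₂]
  refine interval_induction (Q := fun c d => P (Ioo a b ×ˢ Ioo c d)) ?_ ?_ ?_ c d
  · intro c d c' d' h₁ h₂
    exact mono (prod_mono subset_rfl (Ioo_subset_Ioo h₁ h₂))
  · intro c d c' d' h₁ h₂ h₃ hP hP'
    by_cases hab : a < b
    · have := glue op op (by rw [prod_inter_prod, inter_self, inter h₁ h₃]; exact conn hab h₂) hP hP'
      rwa [← prod_union, union h₁ h₂ h₃] at this
    · rw [Ioo_eq_empty hab, empty_prod]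
      exact empty
  · intro y
    -- A horizontal induction builds a thin strip around height `y`, whose thickness may shrink at
    -- each gluing; the outer induction stacks the strips.
    refine interval_induction
      (Q := fun a b => ∃ ε > 0, P (Ioo a b ×ˢ Ioo (y - ε) (y + ε))) ?_ ?_ ?_ a b
    · rintro a b a' b' h₁ h₂ ⟨ε, hε, hP⟩
      exact ⟨ε, hε, mono (prod_mono (Ioo_subset_Ioo h₁ h₂) subset_rfl) hP⟩
    · rintro a b a' b' h₁ h₂ h₃ ⟨ε, hε, hP⟩ ⟨ε', hε', hP'⟩
      have hδ : 0 < min ε ε' := lt_min hε hε'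
      have m₁ : min ε ε' ≤ ε := min_le_left _ _
      have m₂ : min ε ε' ≤ ε' := min_le_right _ _
      refine ⟨min ε ε', hδ, ?_⟩
      have := glue op op (V := Ioo a b ×ˢ Ioo (y - min ε ε') (y + min ε ε'))
        (W := Ioo a' b' ×ˢ Ioo (y - min ε ε') (y + min ε ε'))
        (by rw [prod_inter_prod, inter_self, inter h₁ h₃]; exact conn h₂ (by linarith))
        (mono (prod_mono subset_rfl (Ioo_subset_Ioo (by linarith) (by linarith))) hP)
        (mono (prod_mono subset_rfl (Ioo_subset_Ioo (by linarith) (by linarith))) hP')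
      rwa [← union_prod, union h₁ h₂ h₃] at this
    · intro x
      obtain ⟨W, hW, hP⟩ := loc (x, y)
      obtain ⟨ε, hε, hball⟩ := Metric.mem_nhds_iff.1 hW
      refine ⟨ε, hε, ε, hε, mono ?_ hP⟩
      rw [← Real.ball_eq_Ioo, ← Real.ball_eq_Ioo, ball_prod_same]
      exact hball

end Rectangles

/-! ### Gluing over the sphere -/

section Preimages

variable {M B : Type*} [TopologicalSpace M] [TopologicalSpace B] {p : M → B}

/-- The preimage of a connected open set is path connected if this holds for arbitrarily small
neighbourhoods of every point. -/
theorem isPathConnected_preimage_of_locally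
    (hloc : ∀ b, ∀ W ∈ 𝓝 b, ∃ U ⊆ W, U ∈ 𝓝 b ∧ IsPathConnected (p ⁻¹' U)) (hp : Function.Surjective p)
    {W : Set B} (hW : IsOpen W) (hc : IsConnected W) : IsPathConnected (p ⁻¹' W) := by
  obtain ⟨⟨b₀, hb₀⟩, hpc⟩ := hc
  obtain ⟨x₀, rfl⟩ := hp b₀
  have key : ∀ b ∈ W, ∀ b' ∈ W, ∀ x y, p x = b → p y = b' → JoinedIn (p ⁻¹' W) x y := by
    intro b hb b' hb'
    refine hpc.induction₂ (fun b b' => ∀ x y, p x = b → p y = b' → JoinedIn (p ⁻¹' W) x y) ?_ ?_ ?_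
      hb hb'
    · intro b hb
      obtain ⟨U, hUW, hU, hpath⟩ := hloc b W (hW.mem_nhds hb)
      refine mem_nhdsWithin_of_mem_nhds ?_
      filter_upwards [hU] with b' hb' x y hx hy
      refine (hpath.joinedIn x ?_ y ?_).mono (preimage_mono hUW)
      · rw [mem_preimage, hx]
        exact mem_of_mem_nhds hU
      · rw [mem_preimage, hy]
        exact hb'
    · intro b₁ b₂ b₃ _ _ _ h₁₂ h₂₃ x y hx hy
      obtain ⟨z, hz⟩ := hp b₂
      exact (h₁₂ x z hx hz).trans (h₂₃ z y hz hy)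
    · intro b₁ b₂ _ _ h x y hx hy
      exact (h y x hy hx).symm
  exact ⟨x₀, hb₀, fun {y} hy => key _ hb₀ _ hy _ _ rfl rfl⟩

/-- A plane covering the complement of a point in the sphere. -/
theorem exists_plane_isOpenEmbedding (N : TwoSphere) :
    ∃ ρ : ℝ × ℝ → TwoSphere, IsOpenEmbedding ρ ∧ range ρ = {N}ᶜ := by
  have : Fact (Module.finrank ℝ (EuclideanSpace ℝ (Fin 3)) = 2 + 1) := ⟨by simp⟩
  let e := (stereographic' 2 N).symm
  have he : e.source = univ := stereographic'_target N
  let E : ℝ × ℝ ≃ₜ EuclideanSpace ℝ (Fin 2) :=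
    (Homeomorph.finTwoArrow (X := ℝ)).symm.trans
      (EuclideanSpace.equiv (Fin 2) ℝ).toHomeomorph.symm
  refine ⟨e ∘ E, (e.isOpenEmbedding he).comp E.isOpenEmbedding, ?_⟩
  rw [range_comp, E.surjective.range_eq, ← he, e.image_source_eq_target]
  exact stereographic'_source N

/-- A cocycle on a space over the sphere vanishes on loops if it does so locally over the
sphere. -/
theorem PathCocycle.trivialOn_univ_of_sphere {K : Type*} [Group K] (v : PathCocycle M K)
    {p : M → TwoSphere} (hpc : Continuous p) (hp : Function.Surjective p)
    (hloc : ∀ b, ∀ W ∈ 𝓝 b, ∃ U ⊆ W, U ∈ 𝓝 b ∧ IsPathConnected (p ⁻¹' U))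
    (hv : ∀ b, ∃ U ∈ 𝓝 b, v.TrivialOn (p ⁻¹' U)) : v.TrivialOn univ := by
  have hN : ∀ N : TwoSphere, v.TrivialOn (p ⁻¹' {N}ᶜ) := by
    intro N
    obtain ⟨ρ, hρ, hrange⟩ := exists_plane_isOpenEmbedding N
    have rect : ∀ a b c d : ℝ, v.TrivialOn (p ⁻¹' (ρ '' (Ioo a b ×ˢ Ioo c d))) := by
      refine rectangle_induction (P := fun W => v.TrivialOn (p ⁻¹' (ρ '' W))) ?_ ?_ ?_
      · exact fun h h' => h'.mono (preimage_mono (image_mono h))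
      · intro V W hV hW hconn h h'
        rw [image_union, preimage_union]
        refine h.union h' ((hρ.isOpenMap _ hV).preimage hpc) ((hρ.isOpenMap _ hW).preimage hpc) ?_
        rw [← preimage_inter, ← image_inter hρ.injective]
        exact isPathConnected_preimage_of_locally hloc hp (hρ.isOpenMap _ (hV.inter hW))
          (hconn.image _ hρ.continuous.continuousOn)
      · intro z
        obtain ⟨U, hU, h⟩ := hv (ρ z)
        exact ⟨ρ ⁻¹' U, hρ.continuous.continuousAt hU,
          h.mono (preimage_mono (image_preimage_subset _ _))⟩
    -- The image of a loop is compact in the punctured sphere, so a single rectangle of the plane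
    -- contains it.
    intro x u hu
    have hsub : p '' range u ⊆ range ρ := by
      rw [hrange]
      exact image_subset_iff.2 hu
    have hcomp : IsCompact (ρ ⁻¹' (p '' range u)) :=
      hρ.isInducing.isCompact_preimage' ((isCompact_range u.continuous).image hpc) hsub
    obtain ⟨R, hR⟩ := hcomp.isBounded.subset_ball (0, 0)
    refine rect (0 - R) (0 + R) (0 - R) (0 + R) u fun m hm => ?_
    obtain ⟨z, hz⟩ := hsub (mem_image_of_mem p hm)
    refine ⟨z, ?_, hz⟩
    rw [← Real.ball_eq_Ioo, ball_prod_same]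
    exact hR (by rw [mem_preimage, hz]; exact mem_image_of_mem p hm)
  obtain ⟨N, S, hNS⟩ : ∃ N S : TwoSphere, N ≠ S := by
    obtain ⟨N⟩ : Nonempty TwoSphere := (NormedSpace.sphere_nonempty.2 zero_le_one).to_subtype
    exact ⟨N, -N, fun h => ne_neg_of_mem_unit_sphere ℝ N h⟩
  have hcover : p ⁻¹' {N}ᶜ ∪ p ⁻¹' {S}ᶜ = univ := by
    rw [← preimage_union, ← compl_inter, singleton_inter_eq_empty.2 (by simpa using hNS),
      compl_empty, preimage_univ]
  rw [← hcover]
  refine (hN N).union (hN S) (isOpen_compl_singleton.preimage hpc)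
    (isOpen_compl_singleton.preimage hpc) ?_
  rw [← preimage_inter]
  refine isPathConnected_preimage_of_locally hloc hp
    (isOpen_compl_singleton.inter isOpen_compl_singleton) ?_
  obtain ⟨ρ, hρ, hrange⟩ := exists_plane_isOpenEmbedding N
  obtain ⟨z, hz⟩ : S ∈ range ρ := by
    rw [hrange]
    exact hNS.symm
  -- The overlap of the two planes is a punctured plane, which is connected.
  have : ({N}ᶜ ∩ {S}ᶜ : Set TwoSphere) = ρ '' {z}ᶜ := by
    rw [← hrange, ← hz, ← image_singleton, image_compl_eq_range_sdiff_image hρ.injective, sdiff_eq]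
  rw [this]
  refine (isConnected_compl_singleton_of_one_lt_rank ?_ z).image _ hρ.continuous.continuousOn
  rw [← Module.finrank_eq_rank, Module.finrank_prod, Module.finrank_self]
  norm_num

theorem twoSphere_isConnected_univ : IsConnected (univ : Set TwoSphere) := by
  have h : IsConnected (Metric.sphere (0 : EuclideanSpace ℝ (Fin 3)) 1) := by
    refine isConnected_sphere ?_ 0 zero_le_one
    rw [← Module.finrank_eq_rank, finrank_euclideanSpace_fin]
    norm_num
  have := isConnected_iff_connectedSpace.1 h
  exact isConnected_univ

end Preimages

/-! ### Seifert fibred manifolds over the sphere -/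

section Seifert

variable {M : Type*} [TopologicalSpace M]

/-- If fibred solid tori cover a space over the sphere, then a regular fibre generates a normal
subgroup of the fundamental group, and the fundamental group is generated by roots of elements of
this subgroup. -/
theorem FundamentalGroup.exists_periodic_generators {p : M → TwoSphere} (hpc : Continuous p)
    {a : TwoSphere → ℕ} (hfin : {b | a b ≠ 1}.Finite)
    (hchart : ∀ b, ∀ W ∈ 𝓝 b, ∃ U ⊆ W, IsTorusChart p b (a b) U) (m : M) :
    ∃ (S : Set (FundamentalGroup M m)) (h : FundamentalGroup M m), Subgroup.closure S = ⊤ ∧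
      (∀ g : FundamentalGroup M m, g * h * g⁻¹ ∈ Subgroup.zpowers h) ∧
      ∀ s ∈ S, ∃ k : ℕ, k ≠ 0 ∧ s ^ k ∈ Subgroup.zpowers h := by
  have hloc : ∀ b, ∀ W ∈ 𝓝 b, ∃ U ⊆ W, U ∈ 𝓝 b ∧ IsPathConnected (p ⁻¹' U) := by
    intro b W hW
    obtain ⟨U, hUW, hU⟩ := hchart b W hW
    exact ⟨U, hUW, hU.isOpen.mem_nhds hU.mem, hU.isPathConnected⟩
  have hsurj : Function.Surjective p := by
    intro b
    obtain ⟨U, -, hU⟩ := hchart b univ univ_mem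
    obtain ⟨ν, Ψ, -, -, -, -, hcore⟩ := hU.exists_param
    exact ⟨Ψ (⟨0, by simp⟩, 1), (hcore _).2 rfl⟩
  -- Each chart avoids all cone points other than its centre.
  choose U hUsub hU using fun b => hchart b ({c | a c ≠ 1} \ {b})ᶜ
    ((hfin.subset sdiff_subset).isClosed.isOpen_compl.mem_nhds (by simp))
  -- Away from the centre of `U b`, the point `p y` has multiplicity one, and both sides consist of
  -- the loops in the fibre through `y`. So this subgroup at `y` does not depend on the chart.
  have agree : ∀ b (y : M), p y ∈ U b →
      loopPowers (p ⁻¹' U b) (a b) y = loopPowers (p ⁻¹' U (p y)) (a (p y)) y := by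
    intro b y hy
    by_cases hb : p y = b
    · rw [hb]
    · rw [(hU b).loopPowers_eq_fibre hy (Or.inl hb), (hU (p y)).loopPowers_eq_fibre (hU (p y)).mem]
      right
      by_contra h
      exact hUsub b hy ⟨h, hb⟩
  -- A path within one chart transports the subgroup of powers at one end into that at the other.
  -- Subdividing gives this for all paths; for loops it is normality of `⟨h⟩`.
  have hconj : ∀ {x y : M} (q : Path.Homotopic.Quotient x y),
      ∀ g ∈ loopPowers (p ⁻¹' U (p y)) (a (p y)) y,
        pathConj q g ∈ loopPowers (p ⁻¹' U (p x)) (a (p x)) x := by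
    intro x y q
    obtain ⟨u, rfl⟩ := Path.Homotopic.Quotient.mk_surjective q
    refine Path.Homotopic.Quotient.induction_of_open_cover
      (V := fun b => p ⁻¹' U b) (fun b => (hU b).isOpen.preimage hpc)
      (Q := fun x y q => ∀ g ∈ loopPowers (p ⁻¹' U (p y)) (a (p y)) y,
        pathConj q g ∈ loopPowers (p ⁻¹' U (p x)) (a (p x)) x) ?_ u
      (fun t => ⟨p (u t), (hU _).mem⟩) ?_
    · intro x y z q r hq hr g hg
      rw [pathConj_trans]
      exact hq _ (hr _ hg)
    · intro x y w b hw _ g hg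
      rw [← agree b x (hw ⟨0, w.source⟩)]
      rw [← agree b y (hw ⟨1, w.target⟩)] at hg
      exact pathConj_mem_loopPowers w hw hg
  obtain ⟨h, hh⟩ := (hU (p m)).exists_loopPowers_eq_zpowers (x := m) (hU (p m)).mem
  let S : Set (FundamentalGroup M m) := {g | ∃ (b : TwoSphere) (y : M)
    (γ : Path.Homotopic.Quotient m y) (u : Path y y), range u ⊆ p ⁻¹' U b ∧
      g = pathConj γ (FundamentalGroup.fromPath (Path.Homotopic.Quotient.mk u))}
  refine ⟨S, h, ?_, ?_, ?_⟩
  · have hM : IsPathConnected (univ : Set M) := by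
      have := isPathConnected_preimage_of_locally hloc hsurj isOpen_univ twoSphere_isConnected_univ
      rwa [preimage_univ] at this
    have hγ : ∀ y : M, Nonempty (Path.Homotopic.Quotient m y) := fun y =>
      ⟨Path.Homotopic.Quotient.mk (hM.joinedIn m (mem_univ m) y (mem_univ y)).somePath⟩
    let γ : ∀ y : M, Path.Homotopic.Quotient m y := fun y => (hγ y).some
    -- Modulo `N`, path classes closed up by the chosen paths `γ` define a cocycle that is trivial
    -- over each chart. Gluing over the sphere makes it trivial on all loops, so `N` is the whole
    -- group.
    let N := Subgroup.normalClosure S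
    let v : PathCocycle M (FundamentalGroup M m ⧸ N) :=
      { val := fun x y q => QuotientGroup.mk' N
          (FundamentalGroup.fromPath ((γ x).trans (q.trans (γ y).symm)))
        val_trans := by
          intro x y z q r
          rw [← map_mul]
          congr 1
          change (γ x).trans ((q.trans r).trans (γ z).symm) =
            ((γ x).trans (q.trans (γ y).symm)).trans ((γ y).trans (r.trans (γ z).symm))
          grind }
    have hv : v.TrivialOn univ := by
      refine v.trivialOn_univ_of_sphere hpc hsurj hloc fun b =>
        ⟨U b, (hU b).isOpen.mem_nhds (hU b).mem, fun x u hu => ?_⟩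
      exact (QuotientGroup.eq_one_iff _).2
        (Subgroup.subset_normalClosure ⟨b, x, γ x, u, hu, rfl⟩)
    rw [eq_top_iff]
    intro g _
    have hg : g ∈ N := by
      obtain ⟨u, hu⟩ := Path.Homotopic.Quotient.mk_surjective (FundamentalGroup.toPath g)
      have h₁ := (QuotientGroup.eq_one_iff _).1 (hv u (subset_univ _))
      rw [hu] at h₁
      let d : FundamentalGroup M m := FundamentalGroup.fromPath (γ m)
      have h₂ : pathConj (FundamentalGroup.toPath d) g ∈ N := h₁
      rw [pathConj_self] at h₂
      have h₃ := Subgroup.Normal.conj_mem (inferInstance : N.Normal) _ h₂ d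
      rwa [show d * (d⁻¹ * g * d) * d⁻¹ = g by group] at h₃
    -- `S` is already closed under conjugation, as the connecting path `γ` is arbitrary, so its
    -- closure is its normal closure.
    refine Subgroup.closure_mono ?_ hg
    intro c hc
    obtain ⟨s, ⟨b, y, δ, u, hu, rfl⟩, hs⟩ := Group.mem_conjugatesOfSet_iff.1 hc
    obtain ⟨d, rfl⟩ := isConj_iff.1 hs
    refine ⟨b, y, (FundamentalGroup.toPath d⁻¹).trans δ, u, hu, ?_⟩
    rw [pathConj_trans, pathConj_self, inv_inv]
  · intro g
    have := hconj (FundamentalGroup.toPath g⁻¹) h (by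
      rw [hh]
      exact Subgroup.mem_zpowers h)
    rwa [hh, pathConj_self, inv_inv] at this
  · rintro _ ⟨b, y, δ, u, hu, rfl⟩
    refine ⟨a b, (hU b).ne_zero, ?_⟩
    have := hconj δ _ ((agree b y (hu ⟨0, u.source⟩)).le ⟨u, hu, rfl⟩)
    rwa [hh, map_pow] at this

theorem exists_genuine_tendsto_of_seifert {G : Type*} [Group G] [Nontrivial G] {n : ℕ}
    {α : Fin n → ℕ} {m : M} (hM : IsClosedSeifertOverSphere M α) (e : G ≃* FundamentalGroup M m)
    {P : Set G} (hP : P ∈ leftOrderings G) :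
    ∃ c : ℕ → circularOrderings G, (∀ k, c k ∈ genuineOrderings G) ∧
      Tendsto c atTop (𝓝 (secretOrdering ⟨P, hP⟩)) := by
  classical
  obtain ⟨-, -, hα, p, x, hpc, -, hx, hreg⟩ := hM
  let a : TwoSphere → ℕ := fun b => if h : ∃ i, x i = b then α h.choose else 1
  have hfin : {b | a b ≠ 1}.Finite := by
    refine (finite_range x).subset fun b hb => ?_
    by_contra h
    exact hb (dif_neg h)
  have hchart : ∀ b, ∀ W ∈ 𝓝 b, ∃ U ⊆ W, IsTorusChart p b (a b) U := by
    intro b W hW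
    by_cases h : ∃ i, x i = b
    · have hab : a b = α h.choose := dif_pos h
      have hc := hx h.choose
      rw [h.choose_spec, ← hab] at hc
      exact hc.exists_isTorusChart (by rw [hab]; exact Nat.one_le_iff_ne_zero.1 (hα _)) hW
    · have hab : a b = 1 := dif_neg h
      rw [hab]
      exact (hreg b h).exists_isTorusChart one_ne_zero hW
  obtain ⟨S, h, hS, hnorm, hpow⟩ := FundamentalGroup.exists_periodic_generators hpc hfin hchart m
  have hz : ∀ y ∈ Subgroup.zpowers h, e.symm y ∈ Subgroup.zpowers (e.symm h) := by
    rintro _ ⟨n, rfl⟩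
    exact ⟨n, (map_zpow e.symm h n).symm⟩
  refine exists_genuine_tendsto_of_periodic (S := e.symm '' S) (h := e.symm h) ?_ ?_ ?_ hP
  · have := MonoidHom.map_closure e.symm.toMonoidHom S
    rw [hS] at this
    refine this.symm.trans ?_
    exact Subgroup.map_top_of_surjective _ e.symm.surjective
  · intro g
    have := hz _ (hnorm (e g))
    rwa [map_mul, map_mul, map_inv, e.symm_apply_apply] at this
  · rintro _ ⟨s, hs, rfl⟩
    obtain ⟨k, hk, hks⟩ := hpow s hs
    exact ⟨k, hk, by rw [← map_pow]; exact hz _ hks⟩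

end Seifert

theorem theorem1p2 (G : Type*) [Group G] [Nontrivial G]
    (hG : (Group.FG G ∧ Group.IsNilpotent G) ∨
      (∃ n : ℕ, Nonempty (G ≃* BraidGroup n)) ∨
      (∃ (M : Type*) (_ : TopologicalSpace M) (n : ℕ) (α : Fin n → ℕ) (m : M),
        IsClosedSeifertOverSphere M α ∧ Nonempty (G ≃* FundamentalGroup M m))) :
    Dense (genuineOrderings G) ∧
      ∀ P : leftOrderings G,
        AccPt (secretOrdering P) (𝓟 (genuineOrderings G)) ∧
          ∃ c : ℕ → circularOrderings G, (∀ k, c k ∈ genuineOrderings G) ∧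
            Tendsto c atTop (𝓝 (secretOrdering P)) := by
  refine dense_and_accPt_of_exists_genuine_tendsto fun ⟨P, hP⟩ => ?_
  rcases hG with ⟨hfg, hnil⟩ | ⟨n, ⟨e⟩⟩ | ⟨M, _, n, α, m, hM, ⟨e⟩⟩
  · exact exists_genuine_tendsto_of_nilpotent hfg hP
  · exact exists_genuine_tendsto_of_braid e hP
  · exact exists_genuine_tendsto_of_seifert hM e hP
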